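/- Let $d\ge 1$, let $f$ be a probability density on $\mathbb{R}^d$ with respect to Lebesgue measure, let $X_1,X_2,\ldots$ be i.i.d. random vectors with density $f$, and let $\rho(x,y)$ be the Euclidean distance. Put $V_d=\pi^{d/2}/\Gamma(d/2+1)$ (the volume of the unit ball), $\gamma=-\int_0^\infty e^{-t}\log t\,dt$ (Euler's constant), and, for $N\ge 2$ and $1\le i\le N$, $\rho_i=\min\{\rho(X_i,X_j): 1\le j\le N,\ j\ne i\}$. The Kozachenko–Leonenko estimator of the differential entropy $H=-\int_{\mathbb{R}^d} f(x)\log f(x)\,dx$ (with $0\log 0=0$) is $$H_N = d\log\big((\rho_1\cdots\rho_N)^{1/N}\big)+\log V_d+\gamma+\log(N-1).$$ Let $G(t)=0$ for $0\le t<1$ and $G(t)=t\log t$ for $t\ge 1$. For $x\in\mathbb{R}^d$ and $r,R>0$ let $$I_f(x,r)=\frac{1}{r^dV_d}\int_{\rho(x,y)\le r} f(y)\,dy,\qquad M_f(x,R)=\sup_{r\in(0,R]} I_f(x,r),\qquad m_f(x,R)=\inf_{r\in(0,R]} I_f(x,r),$$ and, for $\varepsilon,R>0$, define the following functionals with values in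 $[0,\infty]$ (with $0^{-\varepsilon}=\infty$ and the integrals in $x$ taken over $\{f>0\}$): $$K_{f,2}(\varepsilon)=\int_{\mathbb{R}^d}\Big(\int_{\mathbb{R}^d\setminus\{x\}} G\big(\log^2\rho(x,y)\big)f(y)\,dy\Big)^{1+\varepsilon}f(x)\,dx,$$ $$Q_f(\varepsilon,R)=\int_{\mathbb{R}^d} M_f(x,R)^{\varepsilon}f(x)\,dx,\qquad T_f(\varepsilon,R)=\int_{\mathbb{R}^d} m_f(x,R)^{-\varepsilon}f(x)\,dx.$$ **Theorem 2.** Assume that $K_{f,2}(\varepsilon_0)<\infty$, $Q_f(\varepsilon_1,R_1)<\infty$ and $T_f(\varepsilon_2,R_2)<\infty$ for some positive $\varepsilon_0,\varepsilon_1,\varepsilon_2,R_1,R_2$. Then $f\log f$ is integrable, so that $H$ is finite, and the estimators $H_N$ are $L^2$-consistent: $$\mathsf{E}(H_N-H)^2\to 0\qquad (N\to\infty).$$ -/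

import Mathlib

open MeasureTheory ProbabilityTheory Filter Topology
open scoped ENNReal

noncomputable section

namespace KozachenkoLeonenko

/-- `G t = 0` for `t < 1` and `G t = t log t` for `t ≥ 1`. -/
def G (t : ℝ) : ℝ := if t < 1 then 0 else t * Real.log t

/-- The volume `π ^ (d / 2) / Γ (d / 2 + 1)` of the unit ball of `ℝ ^ d`. -/
def unitBallVol (d : ℕ) : ℝ := Real.pi ^ ((d : ℝ) / 2) / Real.Gamma ((d : ℝ) / 2 + 1)

variable {d : ℕ}

/-- The average of the density `f` over the closed ball of radius `r` about `x`. -/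
def ballAvg (f : EuclideanSpace ℝ (Fin d) → ℝ) (x : EuclideanSpace ℝ (Fin d)) (r : ℝ) : ℝ≥0∞ :=
  (∫⁻ y in Metric.closedBall x r, ENNReal.ofReal (f y)) / ENNReal.ofReal (r ^ d * unitBallVol d)

/-- The supremum of the averages of `f` over the balls about `x` of radius `r ∈ (0, R]`. -/
def maxAvg (f : EuclideanSpace ℝ (Fin d) → ℝ) (x : EuclideanSpace ℝ (Fin d)) (R : ℝ) : ℝ≥0∞ :=
  ⨆ r ∈ Set.Ioc 0 R, ballAvg f x r

/-- The infimum of the averages of `f` over the balls about `x` of radius `r ∈ (0, R]`. -/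
def minAvg (f : EuclideanSpace ℝ (Fin d) → ℝ) (x : EuclideanSpace ℝ (Fin d)) (R : ℝ) : ℝ≥0∞ :=
  ⨅ r ∈ Set.Ioc 0 R, ballAvg f x r

/-- `∫ (∫ G (log² |x - y|) f(y) dy) ^ (1 + ε) f(x) dx`, with values in `[0, ∞]`; the point
`y = x`, where the logarithm is not defined, is left out of the inner integral. -/
def K₂ (f : EuclideanSpace ℝ (Fin d) → ℝ) (ε : ℝ) : ℝ≥0∞ :=
  ∫⁻ x, (∫⁻ y in {x}ᶜ, ENNReal.ofReal (G (Real.log (dist x y) ^ 2)) * ENNReal.ofReal (f y))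
    ^ (1 + ε) * ENNReal.ofReal (f x)

/-- `∫ M_f(x, R) ^ ε f(x) dx`, with values in `[0, ∞]`. -/
def Q (f : EuclideanSpace ℝ (Fin d) → ℝ) (ε R : ℝ) : ℝ≥0∞ :=
  ∫⁻ x, maxAvg f x R ^ ε * ENNReal.ofReal (f x)

/-- `∫ m_f(x, R) ^ (-ε) f(x) dx`, with values in `[0, ∞]`; here `0 ^ (-ε) = ∞` for `ε > 0`. -/
def T (f : EuclideanSpace ℝ (Fin d) → ℝ) (ε R : ℝ) : ℝ≥0∞ :=
  ∫⁻ x, minAvg f x R ^ (-ε) * ENNReal.ofReal (f x)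

/-- The differential Shannon entropy of the density `f` (note `0 * Real.log 0 = 0`). -/
def entropy (f : EuclideanSpace ℝ (Fin d) → ℝ) : ℝ := -∫ x, f x * Real.log (f x)

/-- The distance from the `i`-th point of a sample to its nearest neighbour in the sample
(a minimum over a finite set, nonempty as soon as `N ≥ 2`). -/
def nnDist {N : ℕ} (x : Fin N → EuclideanSpace ℝ (Fin d)) (i : Fin N) : ℝ :=
  ⨅ j : {j : Fin N // j ≠ i}, dist (x i) (x j)

/-- The geometric mean of the nearest-neighbour distances of a sample. -/
def meanNNDist {N : ℕ} (x : Fin N → EuclideanSpace ℝ (Fin d)) : ℝ :=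
  (∏ i, nnDist x i) ^ (1 / (N : ℝ))

/-- The Kozachenko–Leonenko estimate of the entropy from a sample of `N` points. -/
def klEstimate {N : ℕ} (x : Fin N → EuclideanSpace ℝ (Fin d)) : ℝ :=
  d * Real.log (meanNNDist x) + Real.log (unitBallVol d) + Real.eulerMascheroniConstant
    + Real.log ((N : ℝ) - 1)

end KozachenkoLeonenko

end

/-!
Write `W i` for the logarithm of `N - 1` times the volume of the nearest-neighbour ball of `X i`;
the estimator is the mean of the `W i` plus Euler's constant.

Cap the nearest-neighbour distances at a radius `R`. Given `X i = x`, the capped `W i` exceeds `s`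
when the other `N - 1` points miss a ball of mass about `exp s * f x / (N - 1)`, which by Lebesgue
differentiation has probability tending to `exp (-(exp s * f x))`. This is the survival function of
`log τ - log (f x)` with `τ` standard exponential, whose mean is the entropy minus Euler's constant
once `x` is averaged over the density. For two sample points the two balls are eventually disjoint,
so the joint survival function factorizes in the limit and the empirical survival functions converge
in mean square at each level `s`. The moments of `minAvg` and `maxAvg` bound the two tails by
`exp (-ε * |s|)`, uniformly in `N`. Since a mean is the integral of its survival function (in the
signed sense of `layerKernel`), Cauchy–Schwarz with the weight `exp (ε / 2 * |s|)` and dominated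
convergence give convergence of the means in mean square.

Capping changes `W i` by `d * log⁺ (ρ i / R)`, where `ρ i` is the nearest-neighbour distance. This
is nonzero only if all other points miss the ball of radius `R` about `X i`, and `ρ i` is at most
the distance to any one of them, so the second moment of `log⁺ (ρ i / R)` is at most the integral of
`log⁺ (dist x y / R) ^ 2` against the probability that the remaining `N - 2` points miss that ball.
This tends to zero, because almost every point lies in the support of the law.
-/

noncomputable section

namespace KozachenkoLeonenko

section SurvivalFunctions

variable {Ω : Type*} [MeasurableSpace Ω] {P : Measure Ω}

/-- The signed layer-cake kernel: for each `w`, its integral over all levels `s` is `w`. -/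
def layerKernel (w s : ℝ) : ℝ :=
  (Set.Ioi s).indicator 1 w - (Set.Iio 0).indicator 1 s

lemma layerKernel_eq_sub (w : ℝ) :
    layerKernel w = (Set.Ico 0 w).indicator 1 - (Set.Ico w 0).indicator 1 := by
  ext s
  rcases lt_or_ge s w with h | h <;> rcases lt_or_ge s 0 with h' | h' <;>
    simp [layerKernel, h, h', not_lt.2, not_le.2]

lemma integrable_indicator_Ico_one (a b : ℝ) :
    Integrable ((Set.Ico a b).indicator (1 : ℝ → ℝ)) :=
  (integrable_indicator_iff measurableSet_Ico).2 (integrableOn_const (C := (1 : ℝ)) (by simp))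

lemma integrable_layerKernel (w : ℝ) : Integrable (layerKernel w) := by
  rw [layerKernel_eq_sub]
  exact (integrable_indicator_Ico_one 0 w).sub (integrable_indicator_Ico_one w 0)

lemma integral_layerKernel (w : ℝ) : ∫ s, layerKernel w s = w := by
  rw [layerKernel_eq_sub, integral_sub' (integrable_indicator_Ico_one 0 w)
    (integrable_indicator_Ico_one w 0), integral_indicator_one measurableSet_Ico,
    integral_indicator_one measurableSet_Ico]
  simp [max_zero_sub_max_neg_zero_eq_self]

lemma integral_norm_layerKernel (w : ℝ) : ∫ s, ‖layerKernel w s‖ = |w| := by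
  have hsign (s : ℝ) : ‖layerKernel w s‖ = SignType.sign w * layerKernel w s := by
    rw [layerKernel_eq_sub]
    rcases lt_trichotomy w 0 with hw | rfl | hw
    · by_cases hs : s ∈ Set.Ico w 0 <;> simp [hw, hs, hw.le]
    · simp
    · by_cases hs : s ∈ Set.Ico 0 w <;> simp [hw, hs, hw.le]
  simp_rw [hsign, integral_const_mul, integral_layerKernel, sign_mul_self]

lemma measurable_layerKernel : Measurable (Function.uncurry layerKernel) := by
  have h₁ : MeasurableSet {p : ℝ × ℝ | p.2 < p.1} :=
    measurableSet_lt measurable_snd measurable_fst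
  have h₂ : MeasurableSet {p : ℝ × ℝ | p.2 < 0} :=
    measurableSet_lt measurable_snd measurable_const
  exact (measurable_one.indicator h₁).sub (measurable_one.indicator h₂)

lemma integrable_layerKernel_prod {Z : Ω → ℝ} (hZ : Integrable Z P) :
    Integrable (fun p : Ω × ℝ => layerKernel (Z p.1) p.2) (P.prod volume) := by
  have hmeas : AEStronglyMeasurable (fun p : Ω × ℝ => layerKernel (Z p.1) p.2)
      (P.prod volume) :=
    (measurable_layerKernel.comp_aemeasurable
      (hZ.aemeasurable.comp_fst.prodMk measurable_snd.aemeasurable)).aestronglyMeasurable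
  rw [integrable_prod_iff hmeas]
  refine ⟨ae_of_all _ fun ω => integrable_layerKernel (Z ω), ?_⟩
  simpa only [integral_norm_layerKernel] using hZ.abs

lemma integral_layerKernel_comp [IsProbabilityMeasure P] {Z : Ω → ℝ} (hZ : AEMeasurable Z P)
    (s : ℝ) : ∫ ω, layerKernel (Z ω) s ∂P
      = P.real {ω | s < Z ω} - (Set.Iio 0).indicator 1 s := by
  have hS : NullMeasurableSet {ω | s < Z ω} P := nullMeasurableSet_lt aemeasurable_const hZ
  have hind : (fun ω => (Set.Ioi s).indicator (1 : ℝ → ℝ) (Z ω)) = {ω | s < Z ω}.indicator 1 :=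
    rfl
  simp only [layerKernel]
  rw [integral_sub _ (integrable_const _), hind, integral_indicator₀ hS]
  · simp
  · exact hind ▸ (integrable_const (1 : ℝ)).indicator₀ hS

lemma integral_survival_sub [IsProbabilityMeasure P] {Z : Ω → ℝ} (hZ : Integrable Z P) :
    ∫ s, (P.real {ω | s < Z ω} - (Set.Iio 0).indicator 1 s) = ∫ ω, Z ω ∂P := by
  have h := integral_integral_swap (f := fun ω => layerKernel (Z ω))
    (integrable_layerKernel_prod hZ)
  simpa only [integral_layerKernel, integral_layerKernel_comp hZ.aemeasurable] using h.symm

lemma integrable_survival_sub [IsProbabilityMeasure P] {Z : Ω → ℝ} (hZ : Integrable Z P) :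
    Integrable fun s => P.real {ω | s < Z ω} - (Set.Iio 0).indicator 1 s := by
  have h := (integrable_layerKernel_prod hZ).integral_prod_right
  simpa only [integral_layerKernel_comp hZ.aemeasurable] using h

lemma measurable_survival [IsFiniteMeasure P] (Z : Ω → ℝ) :
    Measurable fun s => P.real {ω | s < Z ω} :=
  Antitone.measurable fun _ _ hst => measureReal_mono fun _ h => hst.trans_lt h

variable {ι : Type*} [Fintype ι]

/-- The empirical survival function of a finite family of real numbers: the proportion of its
members exceeding `s`. -/
def empSurvival (y : ι → ℝ) (s : ℝ) : ℝ :=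
  (∑ i, (Set.Ioi s).indicator 1 (y i)) / Fintype.card ι

lemma measurable_empSurvival : Measurable fun p : (ι → ℝ) × ℝ => empSurvival p.1 p.2 := by
  refine (Finset.measurable_fun_sum _ fun i _ => ?_).div_const _
  have : MeasurableSet {p : (ι → ℝ) × ℝ | p.2 < p.1 i} :=
    measurableSet_lt measurable_snd ((measurable_pi_apply i).comp measurable_fst)
  exact measurable_one.indicator this

lemma empSurvival_mem_Icc (y : ι → ℝ) (s : ℝ) : empSurvival y s ∈ Set.Icc 0 1 := by
  have h (i : ι) : (Set.Ioi s).indicator (1 : ℝ → ℝ) (y i) ∈ Set.Icc 0 1 :=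
    ⟨Set.indicator_nonneg (by simp) _, Set.indicator_le_self' (by simp) _⟩
  refine ⟨div_nonneg (Finset.sum_nonneg fun i _ => (h i).1) (Nat.cast_nonneg _),
    div_le_one_of_le₀ ?_ (Nat.cast_nonneg _)⟩
  simpa using Finset.sum_le_card_nsmul Finset.univ _ 1 fun i _ => (h i).2

lemma empSurvival_sub_eq [Nonempty ι] (y : ι → ℝ) (s : ℝ) :
    empSurvival y s - (Set.Iio 0).indicator 1 s
      = (∑ i, layerKernel (y i) s) / Fintype.card ι := by
  have : (Fintype.card ι : ℝ) ≠ 0 := by simp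
  simp only [empSurvival, layerKernel, Finset.sum_sub_distrib, Finset.sum_const,
    Finset.card_univ, nsmul_eq_mul]
  field_simp

lemma integral_empSurvival_sub [Nonempty ι] (y : ι → ℝ) :
    ∫ s, (empSurvival y s - (Set.Iio 0).indicator 1 s) = (∑ i, y i) / Fintype.card ι := by
  simp_rw [empSurvival_sub_eq, integral_div,
    integral_finsetSum _ fun i _ => integrable_layerKernel (y i), integral_layerKernel]

lemma integrable_empSurvival_sub [Nonempty ι] (y : ι → ℝ) :
    Integrable fun s => empSurvival y s - (Set.Iio 0).indicator 1 s := by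
  simp_rw [empSurvival_sub_eq]
  exact (integrable_finsetSum _ fun i _ => integrable_layerKernel (y i)).div_const _

lemma mean_sub_integral_eq [Nonempty ι] [IsProbabilityMeasure P] {Z : Ω → ℝ}
    (hZ : Integrable Z P) (y : ι → ℝ) :
    (∑ i, y i) / Fintype.card ι - ∫ ω, Z ω ∂P
      = ∫ s, (empSurvival y s - P.real {ω | s < Z ω}) := by
  rw [← integral_empSurvival_sub, ← integral_survival_sub hZ,
    ← integral_sub (integrable_empSurvival_sub y) (integrable_survival_sub hZ)]
  simp only [sub_sub_sub_cancel_right]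

end SurvivalFunctions

section SquareBounds

lemma sq_lintegral_mul_le {α : Type*} [MeasurableSpace α] {μ : Measure α} {f g : α → ℝ≥0∞}
    (hf : AEMeasurable f μ) (hg : AEMeasurable g μ) :
    (∫⁻ x, f x * g x ∂μ) ^ 2 ≤ (∫⁻ x, f x ^ 2 ∂μ) * ∫⁻ x, g x ^ 2 ∂μ := by
  have hHolder := ENNReal.lintegral_mul_le_Lp_mul_Lq μ Real.HolderConjugate.two_two hf hg
  simp only [Pi.mul_apply, ENNReal.rpow_two] at hHolder
  calc (∫⁻ x, f x * g x ∂μ) ^ 2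
      ≤ ((∫⁻ x, f x ^ 2 ∂μ) ^ (1 / 2 : ℝ) * (∫⁻ x, g x ^ 2 ∂μ) ^ (1 / 2 : ℝ)) ^ 2 := by gcongr
    _ = (∫⁻ x, f x ^ 2 ∂μ) * ∫⁻ x, g x ^ 2 ∂μ := by
        simp [mul_pow, ← ENNReal.rpow_mul_natCast]

lemma ofReal_sq_integral_le {α : Type*} [MeasurableSpace α] {μ : Measure α} {w h : α → ℝ}
    (hw : Measurable w) (hw_pos : ∀ x, 0 < w x) (hh : Measurable h) :
    ENNReal.ofReal ((∫ x, h x ∂μ) ^ 2)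
      ≤ (∫⁻ x, ENNReal.ofReal (w x)⁻¹ ∂μ) * ∫⁻ x, ENNReal.ofReal (w x * h x ^ 2) ∂μ := by
  have hfactor (x : α) :
      ‖h x‖ₑ = ENNReal.ofReal √(w x)⁻¹ * ENNReal.ofReal (√(w x) * |h x|) := by
    rw [← ENNReal.ofReal_mul (Real.sqrt_nonneg _), Real.sqrt_inv,
      inv_mul_cancel_left₀ (Real.sqrt_pos.2 (hw_pos x)).ne', Real.enorm_eq_ofReal_abs]
  calc ENNReal.ofReal ((∫ x, h x ∂μ) ^ 2)
      = ‖∫ x, h x ∂μ‖ₑ ^ 2 := by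
        rw [Real.enorm_eq_ofReal_abs, ← ENNReal.ofReal_pow (abs_nonneg _), sq_abs]
    _ ≤ (∫⁻ x, ‖h x‖ₑ ∂μ) ^ 2 := by gcongr; exact enorm_integral_le_lintegral_enorm h
    _ ≤ (∫⁻ x, ENNReal.ofReal √(w x)⁻¹ ^ 2 ∂μ)
          * ∫⁻ x, ENNReal.ofReal (√(w x) * |h x|) ^ 2 ∂μ := by
        simp_rw [hfactor]
        exact sq_lintegral_mul_le (by fun_prop) (by fun_prop)
    _ = (∫⁻ x, ENNReal.ofReal (w x)⁻¹ ∂μ) * ∫⁻ x, ENNReal.ofReal (w x * h x ^ 2) ∂μ := by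
        have hsq_inv (x : α) : ENNReal.ofReal √(w x)⁻¹ ^ 2 = ENNReal.ofReal (w x)⁻¹ := by
          rw [← ENNReal.ofReal_pow (Real.sqrt_nonneg _), Real.sq_sqrt (inv_pos.2 (hw_pos x)).le]
        have hsq (x : α) :
            ENNReal.ofReal (√(w x) * |h x|) ^ 2 = ENNReal.ofReal (w x * h x ^ 2) := by
          rw [← ENNReal.ofReal_pow (by positivity), mul_pow, Real.sq_sqrt (hw_pos x).le, sq_abs]
        simp_rw [hsq_inv, hsq]

lemma integrable_exp_neg_mul_abs {δ : ℝ} (hδ : 0 < δ) :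
    Integrable fun s : ℝ => Real.exp (-(δ * |s|)) := by
  rw [← integrableOn_univ, ← Set.Iic_union_Ioi (a := (0 : ℝ))]
  refine IntegrableOn.union ?_ ?_
  · refine (integrableOn_exp_mul_Iic hδ 0).congr_fun (fun s hs => ?_) measurableSet_Iic
    simp [abs_of_nonpos (Set.mem_Iic.1 hs)]
  · refine (integrableOn_exp_mul_Ioi (neg_lt_zero.2 hδ) 0).congr_fun (fun s hs => ?_)
      measurableSet_Ioi
    simp [abs_of_pos (Set.mem_Ioi.1 hs)]

lemma ofReal_sq_mul_add_le (c a b : ℝ) : ENNReal.ofReal ((c * a + b) ^ 2)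
    ≤ ENNReal.ofReal (2 * c ^ 2) * ENNReal.ofReal (a ^ 2) + 2 * ENNReal.ofReal (b ^ 2) := by
  rw [← ENNReal.ofReal_ofNat, ← ENNReal.ofReal_mul (by positivity), ← ENNReal.ofReal_mul (by simp),
    ← ENNReal.ofReal_add (by positivity) (by positivity)]
  refine ENNReal.ofReal_le_ofReal (add_sq_le.trans_eq ?_)
  ring

lemma lintegral_sq_mean_le {ι Ω : Type*} [Fintype ι] [MeasurableSpace Ω] {P : Measure Ω}
    {Z : ι → Ω → ℝ} (hZ : ∀ i, Measurable (Z i)) {D : ℝ≥0∞}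
    (hD : ∀ i, ∫⁻ ω, ENNReal.ofReal (Z i ω ^ 2) ∂P ≤ D) :
    ∫⁻ ω, ENNReal.ofReal (((∑ i, Z i ω) / Fintype.card ι) ^ 2) ∂P ≤ D := by
  have hpoint (ω : Ω) : ENNReal.ofReal (((∑ i, Z i ω) / Fintype.card ι) ^ 2)
      ≤ (Fintype.card ι : ℝ≥0∞)⁻¹ * ∑ i, ENNReal.ofReal (Z i ω ^ 2) := by
    rcases isEmpty_or_nonempty ι with _ | _
    · simp
    rw [← ENNReal.ofReal_sum_of_nonneg fun i _ => sq_nonneg _, ← ENNReal.ofReal_natCast,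
      ← ENNReal.ofReal_inv_of_pos (by positivity), ← ENNReal.ofReal_mul (by positivity),
      inv_mul_eq_div]
    exact ENNReal.ofReal_le_ofReal sum_div_card_sq_le_sum_sq_div_card
  calc _ ≤ ∫⁻ ω, (Fintype.card ι : ℝ≥0∞)⁻¹ * ∑ i, ENNReal.ofReal (Z i ω ^ 2) ∂P :=
        lintegral_mono hpoint
    _ = (Fintype.card ι : ℝ≥0∞)⁻¹ * ∑ i, ∫⁻ ω, ENNReal.ofReal (Z i ω ^ 2) ∂P := by
        rw [lintegral_const_mul _ (by fun_prop), lintegral_finsetSum _ (by fun_prop)]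
    _ ≤ (Fintype.card ι : ℝ≥0∞)⁻¹ * ∑ _ : ι, D := by
        gcongr with i
        exact hD i
    _ ≤ D := by
        rw [Finset.sum_const, Finset.card_univ, nsmul_eq_mul, ← mul_assoc]
        exact mul_le_of_le_one_left' (ENNReal.inv_mul_le_one _)

end SquareBounds

section MeanSquareLaw

variable {Ω : Type*} [MeasurableSpace Ω] {P : Measure Ω} [IsProbabilityMeasure P]
  {ι : Type*} [Fintype ι]

lemma measurable_empSurvival_comp {Y : ι → Ω → ℝ} (hY : ∀ i, Measurable (Y i)) (s : ℝ) :
    Measurable fun ω => empSurvival (Y · ω) s :=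
  measurable_empSurvival.comp ((measurable_pi_lambda _ hY).prodMk measurable_const)

lemma integrable_indicator_Ioi_comp {Y : Ω → ℝ} (hY : Measurable Y) (s : ℝ) :
    Integrable (fun ω => (Set.Ioi s).indicator (1 : ℝ → ℝ) (Y ω)) P :=
  (integrable_const (1 : ℝ)).indicator (hY measurableSet_Ioi)

lemma integral_empSurvival [Nonempty ι] {Y : ι → Ω → ℝ} (hY : ∀ i, Measurable (Y i)) {s p : ℝ}
    (hp : ∀ i, P.real {ω | s < Y i ω} = p) : ∫ ω, empSurvival (Y · ω) s ∂P = p := by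
  have hi (i : ι) : ∫ ω, (Set.Ioi s).indicator 1 (Y i ω) ∂P = p :=
    (integral_indicator_one (hY i measurableSet_Ioi)).trans (hp i)
  simp only [empSurvival]
  rw [integral_div, integral_finsetSum _ fun i _ => integrable_indicator_Ioi_comp (hY i) s]
  simp [hi]

lemma sq_empSurvival (y : ι → ℝ) (s : ℝ) : empSurvival y s ^ 2
    = (∑ i, ∑ j, (Set.Ioi s).indicator 1 (min (y i) (y j))) / (Fintype.card ι : ℝ) ^ 2 := by
  have hmin (a b : ℝ) : (Set.Ioi s).indicator (1 : ℝ → ℝ) a * (Set.Ioi s).indicator 1 b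
      = (Set.Ioi s).indicator 1 (min a b) := by
    by_cases ha : s < a <;> by_cases hb : s < b <;> simp [ha, hb]
  rw [empSurvival, div_pow, sq (∑ i, _), Finset.sum_mul_sum]
  simp_rw [hmin]

lemma integral_sq_empSurvival [Nonempty ι] {Y : ι → Ω → ℝ} (hY : ∀ i, Measurable (Y i))
    {s p q : ℝ} (hp : ∀ i, P.real {ω | s < Y i ω} = p)
    (hq : ∀ i j, i ≠ j → P.real {ω | s < Y i ω ∧ s < Y j ω} = q) :
    ∫ ω, empSurvival (Y · ω) s ^ 2 ∂P
      = p / Fintype.card ι + (1 - 1 / Fintype.card ι) * q := by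
  classical
  have hmin (i j : ι) : Measurable fun ω => min (Y i ω) (Y j ω) := (hY i).min (hY j)
  have hpair (i j : ι) : ∫ ω, (Set.Ioi s).indicator 1 (min (Y i ω) (Y j ω)) ∂P
      = if i = j then p else q := by
    refine (integral_indicator_one (hmin i j measurableSet_Ioi)).trans ?_
    simp only [Set.preimage, Set.mem_Ioi, lt_min_iff]
    split_ifs with h
    · simpa [h] using hp j
    · exact hq i j h
  have hrow (i : ι) : ∑ j, (if i = j then p else q) = p + (Fintype.card ι - 1) * q := by
    rw [← Finset.add_sum_erase _ _ (Finset.mem_univ i), if_pos rfl,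
      Finset.sum_congr rfl fun j hj => if_neg (Finset.ne_of_mem_erase hj).symm]
    simp [Finset.card_erase_of_mem, Nat.cast_sub Fintype.card_pos]
  have hcard : (Fintype.card ι : ℝ) ≠ 0 := by simp
  simp only [sq_empSurvival]
  rw [integral_div, integral_finsetSum _ fun i _ => integrable_finsetSum _ fun j _ =>
    integrable_indicator_Ioi_comp (hmin i j) s]
  simp_rw [integral_finsetSum _ fun j _ => integrable_indicator_Ioi_comp (hmin _ j) s,
    hpair, hrow, Finset.sum_const, Finset.card_univ, nsmul_eq_mul]
  field_simp

lemma integrable_empSurvival {Y : ι → Ω → ℝ} (hY : ∀ i, Measurable (Y i)) (s : ℝ) :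
    Integrable (fun ω => empSurvival (Y · ω) s) P :=
  (integrable_finsetSum _ fun i _ => integrable_indicator_Ioi_comp (hY i) s).div_const _

lemma integrable_sq_empSurvival {Y : ι → Ω → ℝ} (hY : ∀ i, Measurable (Y i)) (s : ℝ) :
    Integrable (fun ω => empSurvival (Y · ω) s ^ 2) P := by
  refine (integrable_empSurvival hY s).mono
    ((measurable_empSurvival_comp hY s).pow_const 2).aestronglyMeasurable
    (ae_of_all _ fun ω => ?_)
  have h := empSurvival_mem_Icc (Y · ω) s
  rw [Real.norm_of_nonneg (sq_nonneg _), Real.norm_of_nonneg h.1]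
  exact pow_le_of_le_one h.1 h.2 two_ne_zero

lemma lintegral_sq_empSurvival_sub [Nonempty ι] {Y : ι → Ω → ℝ} (hY : ∀ i, Measurable (Y i))
    {s p : ℝ} (hp : ∀ i, P.real {ω | s < Y i ω} = p) (c : ℝ) :
    ∫⁻ ω, ENNReal.ofReal ((empSurvival (Y · ω) s - c) ^ 2) ∂P
      = ENNReal.ofReal (∫ ω, empSurvival (Y · ω) s ^ 2 ∂P - 2 * p * c + c ^ 2) := by
  have hF2 := integrable_sq_empSurvival (P := P) hY s
  have hcross : Integrable (fun ω => 2 * empSurvival (Y · ω) s * c) P :=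
    ((integrable_empSurvival hY s).const_mul 2).mul_const c
  have hsq : Integrable (fun ω => (empSurvival (Y · ω) s - c) ^ 2) P := by
    simpa only [sub_sq, Pi.add_def] using (hF2.sub' hcross).add (integrable_const (c ^ 2))
  rw [← ofReal_integral_eq_lintegral_ofReal hsq (ae_of_all _ fun ω => sq_nonneg _)]
  simp_rw [sub_sq]
  rw [integral_add (hF2.sub' hcross) (integrable_const _), integral_sub hF2 hcross,
    integral_mul_const, integral_const_mul, integral_empSurvival hY hp]
  simp

lemma lintegral_sq_empSurvival_sub_le [Nonempty ι] {Y : ι → Ω → ℝ}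
    (hY : ∀ i, Measurable (Y i)) {s p c : ℝ} (hp : ∀ i, P.real {ω | s < Y i ω} = p)
    (hc : c ∈ Set.Icc 0 1) :
    ∫⁻ ω, ENNReal.ofReal ((empSurvival (Y · ω) s - c) ^ 2) ∂P
      ≤ ENNReal.ofReal (min (p + c) (1 - p + (1 - c))) := by
  have hsq : ∫ ω, empSurvival (Y · ω) s ^ 2 ∂P ≤ p := by
    rw [← integral_empSurvival hY hp]
    refine integral_mono (integrable_sq_empSurvival hY s) (integrable_empSurvival hY s) fun ω => ?_
    have h := empSurvival_mem_Icc (Y · ω) s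
    exact pow_le_of_le_one h.1 h.2 two_ne_zero
  have hp_mem : p ∈ Set.Icc 0 1 := by
    rw [← hp (Classical.arbitrary ι)]
    exact ⟨measureReal_nonneg, measureReal_le_one⟩
  rw [lintegral_sq_empSurvival_sub hY hp]
  refine ENNReal.ofReal_le_ofReal (le_min ?_ ?_) <;>
    nlinarith [hp_mem.1, hp_mem.2, hc.1, hc.2, mul_nonneg hp_mem.1 hc.1,
      mul_nonneg (sub_nonneg.2 hp_mem.2) (sub_nonneg.2 hc.2)]

end MeanSquareLaw

section MeanSquareConvergence

lemma measurable_empSurvival_prod {Ω : Type*} [MeasurableSpace Ω] {ι : Type*} [Fintype ι]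
    {Y : ι → Ω → ℝ} (hY : ∀ i, Measurable (Y i)) :
    Measurable fun p : Ω × ℝ => empSurvival (Y · p.1) p.2 :=
  measurable_empSurvival.comp
    (((measurable_pi_lambda _ hY).comp measurable_fst).prodMk measurable_snd)

lemma lintegral_sq_integral_le {Ω : Type*} [MeasurableSpace Ω] {P : Measure Ω} [SFinite P]
    {g : Ω → ℝ → ℝ} (hg : Measurable (Function.uncurry g))
    {w : ℝ → ℝ} (hw : Measurable w) (hw_pos : ∀ s, 0 < w s) :
    ∫⁻ ω, ENNReal.ofReal ((∫ s, g ω s) ^ 2) ∂P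
      ≤ (∫⁻ s, ENNReal.ofReal (w s)⁻¹) * ∫⁻ s, ENNReal.ofReal (w s) *
        ∫⁻ ω, ENNReal.ofReal (g ω s ^ 2) ∂P := by
  have hweighted : Measurable fun p : Ω × ℝ => ENNReal.ofReal (w p.2 * g p.1 p.2 ^ 2) :=
    ((hw.comp measurable_snd).mul (hg.pow_const 2)).ennreal_ofReal
  calc ∫⁻ ω, ENNReal.ofReal ((∫ s, g ω s) ^ 2) ∂P
      ≤ ∫⁻ ω, (∫⁻ s, ENNReal.ofReal (w s)⁻¹) * (∫⁻ s, ENNReal.ofReal (w s * g ω s ^ 2)) ∂P :=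
        lintegral_mono fun ω => ofReal_sq_integral_le hw hw_pos hg.of_uncurry_left
    _ = (∫⁻ s, ENNReal.ofReal (w s)⁻¹) * ∫⁻ s, ∫⁻ ω, ENNReal.ofReal (w s * g ω s ^ 2) ∂P := by
        rw [lintegral_const_mul _ hweighted.lintegral_prod_right',
          lintegral_lintegral_swap hweighted.aemeasurable]
    _ = _ := by
        congr 2 with s
        simp_rw [ENNReal.ofReal_mul (hw_pos s).le]
        exact lintegral_const_mul' _ _ ENNReal.ofReal_ne_top

variable {ι : ℕ → Type*} [∀ n, Fintype (ι n)] [∀ n, Nonempty (ι n)]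
  {Ω : ℕ → Type*} [∀ n, MeasurableSpace (Ω n)] {P : ∀ n, Measure (Ω n)}
  [∀ n, IsProbabilityMeasure (P n)] {Y : ∀ n, ι n → Ω n → ℝ} {p q : ℕ → ℝ → ℝ}

lemma tendsto_lintegral_sq_empSurvival_sub
    (hι : Tendsto (fun n => Fintype.card (ι n)) atTop atTop)
    (hY : ∀ n i, Measurable (Y n i)) {s c : ℝ}
    (hp : ∀ n i, (P n).real {ω | s < Y n i ω} = p n s)
    (hq : ∀ n i j, i ≠ j → (P n).real {ω | s < Y n i ω ∧ s < Y n j ω} = q n s)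
    (hp_lim : Tendsto (p · s) atTop (𝓝 c)) (hq_lim : Tendsto (q · s) atTop (𝓝 (c ^ 2))) :
    Tendsto (fun n => ∫⁻ ω, ENNReal.ofReal ((empSurvival (Y n · ω) s - c) ^ 2) ∂P n)
      atTop (𝓝 0) := by
  have hcard : Tendsto (fun n => (Fintype.card (ι n) : ℝ)) atTop atTop :=
    tendsto_natCast_atTop_atTop.comp hι
  have hlim := (((hp_lim.div_atTop hcard).add
    ((tendsto_const_nhds (x := (1 : ℝ))).sub (tendsto_const_nhds (x := (1 : ℝ)) |>.div_atTop hcard)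
      |>.mul hq_lim)).sub ((hp_lim.const_mul 2).mul_const c)).add_const (c ^ 2)
  have hzero : 0 + (1 - 0) * c ^ 2 - 2 * c * c + c ^ 2 = 0 := by ring
  rw [hzero] at hlim
  simpa only [lintegral_sq_empSurvival_sub (hY _) (hp _),
    integral_sq_empSurvival (hY _) (hp _) (hq _), ENNReal.ofReal_zero]
    using ENNReal.tendsto_ofReal hlim

lemma min_add_add_le_two_mul_exp_neg_mul_abs {C ε s u u' v v' : ℝ}
    (hu : u ≤ C * Real.exp (-(ε * s))) (hu' : u' ≤ C * Real.exp (-(ε * s)))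
    (hv : v ≤ C * Real.exp (ε * s)) (hv' : v' ≤ C * Real.exp (ε * s)) :
    min (u + u') (v + v') ≤ 2 * C * Real.exp (-(ε * |s|)) := by
  rcases abs_cases s with ⟨hs, -⟩ | ⟨hs, -⟩ <;> rw [hs]
  · exact (min_le_left _ _).trans (by linarith)
  · rw [mul_neg, neg_neg]
    exact (min_le_right _ _).trans (by linarith)

lemma tendsto_lintegral_exp_mul_lintegral_sq_empSurvival_sub
    (hι : Tendsto (fun n => Fintype.card (ι n)) atTop atTop)
    (hY : ∀ n i, Measurable (Y n i)) {F : ℝ → ℝ} (hF : Measurable F)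
    (hF_mem : ∀ s, F s ∈ Set.Icc 0 1)
    (hp : ∀ n i s, (P n).real {ω | s < Y n i ω} = p n s)
    (hq : ∀ n i j s, i ≠ j → (P n).real {ω | s < Y n i ω ∧ s < Y n j ω} = q n s)
    (hp_lim : ∀ s, Tendsto (p · s) atTop (𝓝 (F s)))
    (hq_lim : ∀ s, Tendsto (q · s) atTop (𝓝 (F s ^ 2)))
    {δ ε C : ℝ} (hδ : δ < ε) (hupper : ∀ᶠ n in atTop, ∀ s, p n s ≤ C * Real.exp (-(ε * s)))
    (hlower : ∀ᶠ n in atTop, ∀ s, 1 - p n s ≤ C * Real.exp (ε * s)) :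
    Tendsto (fun n => ∫⁻ s, ENNReal.ofReal (Real.exp (δ * |s|)) *
      ∫⁻ ω, ENNReal.ofReal ((empSurvival (Y n · ω) s - F s) ^ 2) ∂P n) atTop (𝓝 0) := by
  have hF_upper (s : ℝ) : F s ≤ C * Real.exp (-(ε * s)) :=
    le_of_tendsto (hp_lim s) (hupper.mono fun n hn => hn s)
  have hF_lower (s : ℝ) : 1 - F s ≤ C * Real.exp (ε * s) :=
    le_of_tendsto ((hp_lim s).const_sub 1) (hlower.mono fun n hn => hn s)
  have hmeas (n : ℕ) : Measurable fun s => ENNReal.ofReal (Real.exp (δ * |s|)) *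
      ∫⁻ ω, ENNReal.ofReal ((empSurvival (Y n · ω) s - F s) ^ 2) ∂P n := by
    refine Measurable.mul (by fun_prop) (Measurable.lintegral_prod_left' (f := fun p : Ω n × ℝ =>
      ENNReal.ofReal ((empSurvival (Y n · p.1) p.2 - F p.2) ^ 2)) ?_)
    exact (((measurable_empSurvival_prod (hY n)).sub (hF.comp measurable_snd)).pow_const
      2).ennreal_ofReal
  have hbound : ∀ᶠ n in atTop, ∀ s, ENNReal.ofReal (Real.exp (δ * |s|)) *
      ∫⁻ ω, ENNReal.ofReal ((empSurvival (Y n · ω) s - F s) ^ 2) ∂P n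
        ≤ ENNReal.ofReal (2 * C * Real.exp (-((ε - δ) * |s|))) := by
    filter_upwards [hupper, hlower] with n hn hn' s
    have htail : min (p n s + F s) (1 - p n s + (1 - F s)) ≤ 2 * C * Real.exp (-(ε * |s|)) :=
      min_add_add_le_two_mul_exp_neg_mul_abs (hn s) (hF_upper s) (hn' s) (hF_lower s)
    calc _ ≤ ENNReal.ofReal (Real.exp (δ * |s|)) *
            ENNReal.ofReal (2 * C * Real.exp (-(ε * |s|))) := by
          gcongr
          exact (lintegral_sq_empSurvival_sub_le (hY n) (fun i => hp n i s) (hF_mem s)).trans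
            (ENNReal.ofReal_le_ofReal htail)
      _ = ENNReal.ofReal (2 * C * Real.exp (-((ε - δ) * |s|))) := by
          rw [← ENNReal.ofReal_mul (Real.exp_pos _).le, mul_left_comm, ← Real.exp_add]
          ring_nf
  rw [← lintegral_zero (μ := (volume : Measure ℝ))]
  refine tendsto_lintegral_filter_of_dominated_convergence
    (fun s => ENNReal.ofReal (2 * C * Real.exp (-((ε - δ) * |s|)))) (.of_forall hmeas)
    (hbound.mono fun n hn => ae_of_all _ hn)
    ((integrable_exp_neg_mul_abs (sub_pos.2 hδ)).const_mul _).lintegral_lt_top.ne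
    (ae_of_all _ fun s => ?_)
  simpa using ENNReal.Tendsto.const_mul (tendsto_lintegral_sq_empSurvival_sub hι hY
    (fun n i => hp n i s) (fun n i j => hq n i j s) (hp_lim s) (hq_lim s))
    (Or.inr ENNReal.ofReal_ne_top)

/-- Exponential tails allow dominated convergence over the level `s`. -/
theorem tendsto_lintegral_sq_mean_sub_integral {Ω' : Type*} [MeasurableSpace Ω']
    {P' : Measure Ω'} [IsProbabilityMeasure P'] {Z : Ω' → ℝ}
    (hι : Tendsto (fun n => Fintype.card (ι n)) atTop atTop)
    (hY : ∀ n i, Measurable (Y n i)) (hZ : Integrable Z P')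
    (hp : ∀ n i s, (P n).real {ω | s < Y n i ω} = p n s)
    (hq : ∀ n i j s, i ≠ j → (P n).real {ω | s < Y n i ω ∧ s < Y n j ω} = q n s)
    (hp_lim : ∀ s, Tendsto (p · s) atTop (𝓝 (P'.real {ω | s < Z ω})))
    (hq_lim : ∀ s, Tendsto (q · s) atTop (𝓝 (P'.real {ω | s < Z ω} ^ 2)))
    {ε C : ℝ} (hε : 0 < ε) (hupper : ∀ᶠ n in atTop, ∀ s, p n s ≤ C * Real.exp (-(ε * s)))
    (hlower : ∀ᶠ n in atTop, ∀ s, 1 - p n s ≤ C * Real.exp (ε * s)) :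
    Tendsto (fun n => ∫⁻ ω, ENNReal.ofReal
      (((∑ i, Y n i ω) / Fintype.card (ι n) - ∫ ω', Z ω' ∂P') ^ 2) ∂P n) atTop (𝓝 0) := by
  have hF : Measurable fun s => P'.real {ω | s < Z ω} := measurable_survival Z
  have hweight : ∫⁻ s : ℝ, ENNReal.ofReal (Real.exp (ε / 2 * |s|))⁻¹ ≠ ∞ := by
    simpa only [← Real.exp_neg] using (integrable_exp_neg_mul_abs (half_pos hε)).lintegral_lt_top.ne
  have hdev := tendsto_lintegral_exp_mul_lintegral_sq_empSurvival_sub hι hY hF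
    (fun s => ⟨measureReal_nonneg, measureReal_le_one⟩) hp hq hp_lim hq_lim (half_lt_self hε)
    hupper hlower
  refine tendsto_of_tendsto_of_tendsto_of_le_of_le tendsto_const_nhds
    (mul_zero (∫⁻ s : ℝ, ENNReal.ofReal (Real.exp (ε / 2 * |s|))⁻¹) ▸
      ENNReal.Tendsto.const_mul hdev (Or.inr hweight)) (fun _ => zero_le) fun n => ?_
  simp_rw [mean_sub_integral_eq hZ]
  exact lintegral_sq_integral_le
    ((measurable_empSurvival_prod (hY n)).sub (hF.comp measurable_snd)) (by fun_prop)
    fun s => Real.exp_pos _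

end MeanSquareConvergence

section ProductSamples

lemma lintegral_comp_iIndepFun {ι Ω α : Type*} [Fintype ι] [MeasurableSpace Ω]
    [MeasurableSpace α] {P : Measure Ω} [IsProbabilityMeasure P] {μ : Measure α} {X : ι → Ω → α}
    (hX : ∀ i, Measurable (X i)) (hindep : iIndepFun X P) (hlaw : ∀ i, P.map (X i) = μ)
    {g : (ι → α) → ℝ≥0∞} (hg : Measurable g) :
    ∫⁻ ω, g (X · ω) ∂P = ∫⁻ x, g x ∂Measure.pi fun _ => μ := by
  rw [← lintegral_map hg (measurable_pi_lambda _ hX),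
    (iIndepFun_iff_map_fun_eq_pi_map fun i => (hX i).aemeasurable).1 hindep]
  simp only [hlaw]

variable {α : Type*} [MeasurableSpace α] {μ : Measure α} [SigmaFinite μ]

lemma measurableSet_forall_mem {β : Type*} [MeasurableSpace β] {n : ℕ} {S : Set (β × α)}
    (hS : MeasurableSet S) : MeasurableSet {z : β × (Fin n → α) | ∀ l, (z.1, z.2 l) ∈ S} := by
  have hl (l : Fin n) : Measurable fun z : β × (Fin n → α) => (z.1, z.2 l) := by fun_prop
  rw [Set.ofPred_forall]
  exact MeasurableSet.iInter fun l => hl l hS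

lemma setLIntegral_forall_mem_prod_pi {β : Type*} [MeasurableSpace β] {ν : Measure β}
    {n : ℕ} {S : Set (β × α)} (hS : MeasurableSet S) {g : β → ℝ≥0∞} (hg : Measurable g) :
    ∫⁻ z in {z : β × (Fin n → α) | ∀ l, (z.1, z.2 l) ∈ S}, g z.1
        ∂ν.prod (Measure.pi fun _ : Fin n => μ)
      = ∫⁻ b, g b * μ (Prod.mk b ⁻¹' S) ^ n ∂ν := by
  set A : Set (β × (Fin n → α)) := {z | ∀ l, (z.1, z.2 l) ∈ S}
  have hA : MeasurableSet A := measurableSet_forall_mem hS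
  have hslice (b : β) : Measure.pi (fun _ : Fin n => μ) (Prod.mk b ⁻¹' A)
      = μ (Prod.mk b ⁻¹' S) ^ n := by
    rw [show Prod.mk b ⁻¹' A = Set.univ.pi fun _ => Prod.mk b ⁻¹' S by ext; simp [A],
      Measure.pi_pi, Finset.prod_const, Finset.card_univ, Fintype.card_fin]
  have hgA : Measurable (A.indicator fun z => g z.1) := (hg.comp measurable_fst).indicator hA
  rw [← lintegral_indicator hA, lintegral_prod _ hgA.aemeasurable]
  refine lintegral_congr fun b => ?_
  rw [← hslice, ← setLIntegral_const, ← lintegral_indicator (measurable_prodMk_left hA)]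
  rfl

lemma pi_forall_mem_succAbove {n : ℕ} (i : Fin (n + 1)) {S : Set (α × α)}
    (hS : MeasurableSet S) :
    Measure.pi (fun _ : Fin (n + 1) => μ) {x | ∀ j, (x i, x (i.succAbove j)) ∈ S}
      = ∫⁻ a, μ (Prod.mk a ⁻¹' S) ^ n ∂μ := by
  have hmp := measurePreserving_piFinSuccAbove (fun _ : Fin (n + 1) => μ) i
  have h := setLIntegral_forall_mem_prod_pi (μ := μ) (ν := μ) (n := n) hS
    (measurable_const (a := 1))
  simp only [setLIntegral_one, one_mul] at h
  rw [← h, ← hmp.measure_preimage_equiv]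
  rfl

lemma setLIntegral_forall_mem_succAbove_succAbove {m : ℕ} (i : Fin (m + 2)) (k : Fin (m + 1))
    {S : Set ((α × α) × α)} (hS : MeasurableSet S) {g : α × α → ℝ≥0∞} (hg : Measurable g) :
    ∫⁻ x in {x | ∀ l, ((x i, x (i.succAbove k)), x (i.succAbove (k.succAbove l))) ∈ S},
        g (x i, x (i.succAbove k)) ∂Measure.pi (fun _ : Fin (m + 2) => μ)
      = ∫⁻ p, g p * μ (Prod.mk p ⁻¹' S) ^ m ∂μ.prod μ := by
  have hmp := (measurePreserving_prodAssoc μ μ (Measure.pi fun _ : Fin m => μ)).symm.comp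
    (((MeasurePreserving.id μ).prod
      (measurePreserving_piFinSuccAbove (fun _ : Fin (m + 1) => μ) k)).comp
        (measurePreserving_piFinSuccAbove (fun _ : Fin (m + 2) => μ) i))
  rw [← setLIntegral_forall_mem_prod_pi hS hg]
  exact hmp.setLIntegral_comp_preimage (measurableSet_forall_mem hS) (hg.comp measurable_fst)

end ProductSamples

section NearestNeighbours

lemma measurable_measure_compl_closedBall_union {α : Type*} [PseudoMetricSpace α]
    [SecondCountableTopology α] [MeasurableSpace α] [OpensMeasurableSpace α] (μ : Measure α)
    [SFinite μ] (r : ℝ) : Measurable fun p : α × α =>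
      μ (Metric.closedBall p.1 r ∪ Metric.closedBall p.2 r)ᶜ := by
  have hS : MeasurableSet {q : (α × α) × α |
      ¬(q.2 ∈ Metric.closedBall q.1.1 r ∨ q.2 ∈ Metric.closedBall q.1.2 r)} := by
    exact ((measurableSet_le (by fun_prop) measurable_const).union
      (measurableSet_le (by fun_prop) measurable_const)).compl
  exact measurable_measure_prodMk_left hS

lemma measurable_measure_compl_closedBall {α : Type*} [PseudoMetricSpace α]
    [SecondCountableTopology α] [MeasurableSpace α] [OpensMeasurableSpace α] (μ : Measure α)
    [SFinite μ] (r : ℝ) : Measurable fun x => μ (Metric.closedBall x r)ᶜ := by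
  simpa only [Function.comp_def, id_eq, Set.union_self] using
    (measurable_measure_compl_closedBall_union μ r).comp (measurable_id.prodMk measurable_id)

variable {d : ℕ}

lemma nnDist_le_dist {N : ℕ} (x : Fin N → EuclideanSpace ℝ (Fin d)) {i j : Fin N} (h : j ≠ i) :
    nnDist x i ≤ dist (x i) (x j) :=
  ciInf_le (Set.finite_range _).bddBelow (⟨j, h⟩ : {j : Fin N // j ≠ i})

lemma nnDist_nonneg {N : ℕ} (x : Fin N → EuclideanSpace ℝ (Fin d)) (i : Fin N) :
    0 ≤ nnDist x i :=
  Real.iInf_nonneg fun _ => dist_nonneg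

lemma measurable_nnDist {N : ℕ} (i : Fin N) :
    Measurable fun x : Fin N → EuclideanSpace ℝ (Fin d) => nnDist x i :=
  Measurable.iInf fun j => (measurable_pi_apply i).dist (measurable_pi_apply (j : Fin N))

lemma lt_nnDist_iff {m : ℕ} (x : Fin (m + 2) → EuclideanSpace ℝ (Fin d)) (i : Fin (m + 2))
    (r : ℝ) : r < nnDist x i ↔ ∀ j ≠ i, r < dist (x i) (x j) := by
  have : Nonempty {j // j ≠ i} := nonempty_subtype.2 (exists_ne i)
  refine ⟨fun h j hj => h.trans_le (nnDist_le_dist x hj), fun h => ?_⟩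
  obtain ⟨j, hj⟩ := exists_eq_ciInf_of_finite (f := fun j : {j // j ≠ i} => dist (x i) (x j))
  exact (h j j.2).trans_eq hj

lemma lt_nnDist_iff_succAbove {m : ℕ} (x : Fin (m + 2) → EuclideanSpace ℝ (Fin d))
    (i : Fin (m + 2)) (r : ℝ) :
    r < nnDist x i ↔ ∀ j, r < dist (x i) (x (i.succAbove j)) := by
  simp [lt_nnDist_iff, Fin.forall_iff_succAbove i, Fin.succAbove_ne]

lemma lt_nnDist_and_lt_nnDist_succAbove_iff {m : ℕ} (x : Fin (m + 2) → EuclideanSpace ℝ (Fin d))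
    (i : Fin (m + 2)) (k : Fin (m + 1)) (r : ℝ) :
    r < nnDist x i ∧ r < nnDist x (i.succAbove k) ↔
      r < dist (x i) (x (i.succAbove k)) ∧
        ∀ l, r < dist (x i) (x (i.succAbove (k.succAbove l))) ∧
          r < dist (x (i.succAbove k)) (x (i.succAbove (k.succAbove l))) := by
  simp only [lt_nnDist_iff, Fin.forall_iff_succAbove i, Fin.forall_iff_succAbove k, ne_eq,
    Fin.succAbove_ne, (Fin.succAbove_ne _ _).symm, Fin.succAbove_right_inj, not_true_eq_false,
    not_false_eq_true, IsEmpty.forall_iff, forall_true_left, true_and,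
    dist_comm (x (i.succAbove k)) (x i)]
  grind

variable (μ : Measure (EuclideanSpace ℝ (Fin d))) [SigmaFinite μ]

lemma pi_lt_nnDist (m : ℕ) (i : Fin (m + 2)) (r : ℝ) :
    Measure.pi (fun _ : Fin (m + 2) => μ) {x | r < nnDist x i}
      = ∫⁻ x, μ (Metric.closedBall x r)ᶜ ^ (m + 1) ∂μ := by
  have hS : MeasurableSet {p : EuclideanSpace ℝ (Fin d) × EuclideanSpace ℝ (Fin d) |
      r < dist p.1 p.2} := measurableSet_lt measurable_const (by fun_prop)
  have hslice (x : EuclideanSpace ℝ (Fin d)) :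
      (Metric.closedBall x r)ᶜ = Prod.mk x ⁻¹' {p | r < dist p.1 p.2} := by
    ext y
    simp [dist_comm y]
  simp only [hslice, lt_nnDist_iff_succAbove]
  exact pi_forall_mem_succAbove i hS

lemma pi_lt_nnDist_and_lt_nnDist (m : ℕ) {i j : Fin (m + 2)} (hij : i ≠ j) (r : ℝ) :
    Measure.pi (fun _ : Fin (m + 2) => μ) {x | r < nnDist x i ∧ r < nnDist x j}
      = ∫⁻ p in {p | r < dist p.1 p.2},
          μ (Metric.closedBall p.1 r ∪ Metric.closedBall p.2 r)ᶜ ^ m ∂μ.prod μ := by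
  obtain ⟨k, rfl⟩ := Fin.exists_succAbove_eq hij.symm
  have hS : MeasurableSet {q : (EuclideanSpace ℝ (Fin d) × EuclideanSpace ℝ (Fin d)) ×
      EuclideanSpace ℝ (Fin d) | r < dist q.1.1 q.2 ∧ r < dist q.1.2 q.2} := by
    rw [Set.ofPred_and]
    exact (measurableSet_lt measurable_const (by fun_prop)).inter
      (measurableSet_lt measurable_const (by fun_prop))
  have hD : MeasurableSet {p : EuclideanSpace ℝ (Fin d) × EuclideanSpace ℝ (Fin d) |
      r < dist p.1 p.2} := measurableSet_lt measurable_const (by fun_prop)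
  have hslice (p : EuclideanSpace ℝ (Fin d) × EuclideanSpace ℝ (Fin d)) :
      (Metric.closedBall p.1 r ∪ Metric.closedBall p.2 r)ᶜ
        = Prod.mk p ⁻¹' {q | r < dist q.1.1 q.2 ∧ r < dist q.1.2 q.2} := by
    ext y
    simp [dist_comm y]
  have hpair : Measurable fun x : Fin (m + 2) → EuclideanSpace ℝ (Fin d) =>
      (x i, x (i.succAbove k)) := by fun_prop
  have hdisint := setLIntegral_forall_mem_succAbove_succAbove (μ := μ) i k hS
    ((measurable_one (α := ℝ≥0∞)).indicator hD)
  simp only [hslice]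
  rw [← lintegral_indicator hD]
  refine Eq.trans ?_ (hdisint.trans (lintegral_congr fun p => by simp [Set.indicator_apply]))
  simp only [lt_nnDist_and_lt_nnDist_succAbove_iff]
  exact ((lintegral_indicator_one (hpair hD)).trans (Measure.restrict_apply (hpair hD))).symm

lemma setLIntegral_comp_nnDist_le (m : ℕ) (i : Fin (m + 2)) {φ : ℝ → ℝ≥0∞}
    (hφ : Measurable φ) (hmono : MonotoneOn φ (Set.Ici 0)) (R : ℝ) :
    ∫⁻ x in {x | R < nnDist x i}, φ (nnDist x i) ∂Measure.pi (fun _ : Fin (m + 2) => μ)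
      ≤ ∫⁻ p, φ (dist p.1 p.2) * μ (Metric.closedBall p.1 R)ᶜ ^ m ∂μ.prod μ := by
  have hS : MeasurableSet {q : (EuclideanSpace ℝ (Fin d) × EuclideanSpace ℝ (Fin d)) ×
      EuclideanSpace ℝ (Fin d) | R < dist q.1.1 q.2} :=
    measurableSet_lt measurable_const (by fun_prop)
  have hslice (p : EuclideanSpace ℝ (Fin d) × EuclideanSpace ℝ (Fin d)) :
      (Metric.closedBall p.1 R)ᶜ = Prod.mk p ⁻¹' {q | R < dist q.1.1 q.2} := by
    ext y
    simp [dist_comm y]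
  have hφd : Measurable fun p : EuclideanSpace ℝ (Fin d) × EuclideanSpace ℝ (Fin d) =>
      φ (dist p.1 p.2) := hφ.comp (by fun_prop)
  have hle (x : Fin (m + 2) → EuclideanSpace ℝ (Fin d)) :
      φ (nnDist x i) ≤ φ (dist (x i) (x (i.succAbove 0))) :=
    hmono (nnDist_nonneg x i) dist_nonneg (nnDist_le_dist x (i.succAbove_ne 0))
  simp only [hslice]
  rw [← setLIntegral_forall_mem_succAbove_succAbove (μ := μ) i 0 hS hφd]
  refine (lintegral_mono hle).trans (lintegral_mono_set fun x hx l => ?_)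
  exact (lt_nnDist_iff_succAbove x i R).1 hx _

end NearestNeighbours

section PowerBounds

lemma one_le_pow_add_natCast_mul {p q : ℝ≥0∞} (hpq : p + q = 1) (n : ℕ) :
    1 ≤ q ^ n + n * p := by
  induction n with
  | zero => simp
  | succ n ih =>
    have hq : q ≤ 1 := hpq ▸ le_add_self
    calc (1 : ℝ≥0∞) = 1 * q + p := by rw [one_mul, add_comm, hpq]
      _ ≤ (q ^ n + n * p) * q + p := by gcongr
      _ = q ^ (n + 1) + n * p * q + p := by ring
      _ ≤ q ^ (n + 1) + n * p * 1 + p := by gcongr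
      _ = q ^ (n + 1) + (n + 1 : ℕ) * p := by push_cast; ring

lemma pow_mul_natCast_mul_le_one {p q : ℝ≥0∞} (hpq : p + q = 1) (n : ℕ) :
    q ^ n * (n * p) ≤ 1 := by
  have hq : q ≤ 1 := hpq ▸ le_add_self
  calc q ^ n * (n * p) ≤ q ^ (n - 1) * (n * p) :=
        mul_le_mul_left (pow_le_pow_right_of_le_one' hq n.pred_le) _
    _ ≤ q ^ n + n * q ^ (n - 1) * p := le_add_self.trans_eq' (by ring)
    _ ≤ (q + p) ^ n := pow_add_mul_le_add_pow_of_sq_nonneg zero_le zero_le zero_le zero_le n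
    _ = 1 := by rw [add_comm, hpq, one_pow]

lemma one_le_pow_add_rpow {p q : ℝ≥0∞} (hpq : p + q = 1) (n : ℕ) {ε : ℝ} (hε : 0 < ε)
    (hε1 : ε ≤ 1) : 1 ≤ q ^ n + (n * p) ^ ε := by
  rcases le_total 1 ((n : ℝ≥0∞) * p) with h | h
  · exact (ENNReal.one_le_rpow h hε).trans le_add_self
  · refine (one_le_pow_add_natCast_mul hpq n).trans ?_
    gcongr
    simpa using ENNReal.rpow_le_rpow_of_exponent_ge h hε1

lemma pow_le_rpow_neg {p q : ℝ≥0∞} (hpq : p + q = 1) (n : ℕ) {ε : ℝ} (hε : 0 ≤ ε)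
    (hε1 : ε ≤ 1) : q ^ n ≤ (n * p) ^ (-ε) := by
  rcases le_total 1 ((n : ℝ≥0∞) * p) with h | h
  · calc q ^ n ≤ (n * p)⁻¹ := ENNReal.le_inv_iff_mul_le.2 (pow_mul_natCast_mul_le_one hpq n)
      _ = (n * p) ^ (-1 : ℝ) := (ENNReal.rpow_neg_one _).symm
      _ ≤ (n * p) ^ (-ε) := ENNReal.rpow_le_rpow_of_exponent_le h (neg_le_neg hε1)
  · rw [ENNReal.rpow_neg]
    exact (pow_le_one' (hpq ▸ le_add_self) n).trans
      (ENNReal.one_le_inv.2 (ENNReal.rpow_le_one h hε))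

lemma tendsto_pow_ofReal_exp_neg {p q : ℕ → ℝ≥0∞} (hpq : ∀ m, p m + q m = 1) {t : ℝ}
    (ht : 0 ≤ t) (h : Tendsto (fun m : ℕ => ((m : ℝ≥0∞) + 1) * p m) atTop (𝓝 (ENNReal.ofReal t)))
    (k : ℕ) : Tendsto (fun m => q m ^ (m + k)) atTop (𝓝 (ENNReal.ofReal (Real.exp (-t)))) := by
  have hp (m : ℕ) : p m ≤ 1 := hpq m ▸ le_self_add
  have hq (m : ℕ) : q m = ENNReal.ofReal (1 + -(p m).toReal) := by
    rw [← sub_eq_add_neg, ENNReal.ofReal_sub _ ENNReal.toReal_nonneg, ENNReal.ofReal_one,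
      ENNReal.ofReal_toReal (ne_top_of_le_ne_top ENNReal.one_ne_top (hp m)), ← hpq m,
      ENNReal.add_sub_cancel_left (ne_top_of_le_ne_top ENNReal.one_ne_top (hp m))]
  have h₁ : Tendsto (fun m : ℕ => ((m : ℝ) + 1) * (p m).toReal) atTop (𝓝 t) := by
    have := (ENNReal.tendsto_toReal ENNReal.ofReal_ne_top).comp h
    rw [ENNReal.toReal_ofReal ht] at this
    refine this.congr fun m => ?_
    simp [ENNReal.toReal_add]
  have h₀ : Tendsto (fun m => (p m).toReal) atTop (𝓝 0) := by
    have := h₁.mul (tendsto_one_div_add_atTop_nhds_zero_nat (𝕜 := ℝ))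
    rw [mul_zero] at this
    refine this.congr fun m => ?_
    field_simp
  have hm : Tendsto (fun m : ℕ => (m : ℝ) * -(p m).toReal) atTop (𝓝 (-t)) := by
    have := (h₁.sub h₀).neg
    rw [sub_zero] at this
    refine this.congr fun m => ?_
    ring
  have hk : Tendsto (fun m => (1 + -(p m).toReal) ^ k) atTop (𝓝 1) := by
    simpa using (h₀.neg.const_add 1).pow k
  have hlim := ENNReal.tendsto_ofReal ((Real.tendsto_one_add_pow_exp_of_tendsto hm).mul hk)
  rw [mul_one] at hlim
  refine hlim.congr fun m => ?_
  have hnonneg : 0 ≤ 1 + -(p m).toReal := by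
    linarith [ENNReal.toReal_mono ENNReal.one_ne_top (hp m), ENNReal.toReal_one]
  rw [← pow_add, hq, ENNReal.ofReal_pow hnonneg]

lemma ofReal_exp_rpow {ε : ℝ} (s : ℝ) (hε : 0 ≤ ε) :
    ENNReal.ofReal (Real.exp s) ^ ε = ENNReal.ofReal (Real.exp (ε * s)) := by
  rw [ENNReal.ofReal_rpow_of_nonneg (Real.exp_pos s).le hε, ← Real.exp_mul, mul_comm]

end PowerBounds

section Density

variable {d : ℕ} {f : EuclideanSpace ℝ (Fin d) → ℝ}

/-- The measure with density `f` with respect to Lebesgue measure: the law of the sample points. -/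
abbrev law (f : EuclideanSpace ℝ (Fin d) → ℝ) : Measure (EuclideanSpace ℝ (Fin d)) :=
  volume.withDensity fun x => ENNReal.ofReal (f x)

lemma lintegral_law (hf : AEMeasurable f volume) (g : EuclideanSpace ℝ (Fin d) → ℝ≥0∞) :
    ∫⁻ x, g x ∂law f = ∫⁻ x, g x * ENNReal.ofReal (f x) := by
  rw [lintegral_withDensity_eq_lintegral_mul_non_measurable₀ _ hf.ennreal_ofReal (by simp)]
  simp only [Pi.mul_apply, mul_comm]

lemma integrable_law_iff (hf : AEMeasurable f volume) (hf0 : ∀ x, 0 ≤ f x)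
    {g : EuclideanSpace ℝ (Fin d) → ℝ} :
    Integrable g (law f) ↔ Integrable (fun x => f x * g x) volume := by
  rw [integrable_withDensity_iff_integrable_smul₀' hf.ennreal_ofReal (by simp)]
  simp only [ENNReal.toReal_ofReal (hf0 _), smul_eq_mul]

lemma integral_law (hf : AEMeasurable f volume) (hf0 : ∀ x, 0 ≤ f x)
    (g : EuclideanSpace ℝ (Fin d) → ℝ) : ∫ x, g x ∂law f = ∫ x, f x * g x := by
  rw [integral_withDensity_eq_integral_toReal_smul₀ hf.ennreal_ofReal (by simp)]
  simp only [ENNReal.toReal_ofReal (hf0 _), smul_eq_mul]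

lemma ae_law_of_ae {p : EuclideanSpace ℝ (Fin d) → Prop} (h : ∀ᵐ x, p x) : ∀ᵐ x ∂law f, p x :=
  (withDensity_absolutelyContinuous _ _).ae_le h

lemma law_singleton (hd : 0 < d) (x : EuclideanSpace ℝ (Fin d)) : law f {x} = 0 := by
  have : Nonempty (Fin d) := ⟨⟨0, hd⟩⟩
  exact withDensity_absolutelyContinuous volume _ (measure_singleton x)

lemma ae_prod_law_ne (hd : 0 < d) : ∀ᵐ p ∂(law f).prod (law f), p.1 ≠ p.2 := by
  refine (Measure.ae_prod_iff_ae_ae measurableSet_diagonal.compl).2 (ae_of_all _ fun x => ?_)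
  exact (measure_eq_zero_iff_ae_notMem.1 (law_singleton hd x)).mono fun y hy => Ne.symm hy

lemma ae_law_pos (hf : AEMeasurable f volume) : ∀ᵐ x ∂law f, 0 < f x := by
  rw [ae_withDensity_iff' hf.ennreal_ofReal]
  exact ae_of_all _ fun x hx => by simpa using hx

lemma aemeasurable_law (hf : AEMeasurable f volume) : AEMeasurable f (law f) :=
  hf.mono_ac (withDensity_absolutelyContinuous _ _)

end Density

section BallAverages

variable {d : ℕ} {f : EuclideanSpace ℝ (Fin d) → ℝ} {x : EuclideanSpace ℝ (Fin d)}
  {r R S : ℝ}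

lemma unitBallVol_pos (d : ℕ) : 0 < unitBallVol d :=
  div_pos (Real.rpow_pos_of_pos Real.pi_pos _) (Real.Gamma_pos_of_pos (by positivity))

lemma volume_closedBall_eq (hd : 0 < d) (x : EuclideanSpace ℝ (Fin d)) (hr : 0 ≤ r) :
    volume (Metric.closedBall x r) = ENNReal.ofReal (r ^ d * unitBallVol d) := by
  have : Nonempty (Fin d) := ⟨⟨0, hd⟩⟩
  rw [EuclideanSpace.volume_closedBall, Fintype.card_fin, ← ENNReal.ofReal_pow hr,
    ← ENNReal.ofReal_mul (pow_nonneg hr d), unitBallVol, Real.sqrt_eq_rpow, ← Real.rpow_natCast,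
    ← Real.rpow_natCast, ← Real.rpow_mul Real.pi_pos.le]
  congr 4
  ring

lemma ballAvg_eq_div (f : EuclideanSpace ℝ (Fin d) → ℝ) (x : EuclideanSpace ℝ (Fin d)) (r : ℝ) :
    ballAvg f x r
      = law f (Metric.closedBall x r) / ENNReal.ofReal (r ^ d * unitBallVol d) := by
  rw [ballAvg, withDensity_apply _ Metric.isClosed_closedBall.measurableSet]

lemma law_closedBall_eq (f : EuclideanSpace ℝ (Fin d) → ℝ) (x : EuclideanSpace ℝ (Fin d))
    (hr : 0 < r) : law f (Metric.closedBall x r)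
      = ENNReal.ofReal (r ^ d * unitBallVol d) * ballAvg f x r := by
  have hvol : 0 < r ^ d * unitBallVol d := mul_pos (pow_pos hr d) (unitBallVol_pos d)
  rw [ballAvg_eq_div, ENNReal.mul_div_cancel (by simpa using hvol) ENNReal.ofReal_ne_top]

lemma ae_tendsto_ballAvg (hd : 0 < d) (hf : AEMeasurable f volume) [IsFiniteMeasure (law f)] :
    ∀ᵐ x, Tendsto (ballAvg f x) (𝓝[>] 0) (𝓝 (ENNReal.ofReal (f x))) := by
  filter_upwards [Besicovitch.ae_tendsto_rnDeriv (law f) volume,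
    Measure.rnDeriv_withDensity₀ volume hf.ennreal_ofReal] with x hx hx'
  rw [hx'] at hx
  refine hx.congr' ?_
  filter_upwards [self_mem_nhdsWithin] with r hr
  rw [ballAvg_eq_div, volume_closedBall_eq hd x (le_of_lt hr)]

lemma ballAvg_le_maxAvg (hr : 0 < r) (hrR : r ≤ R) : ballAvg f x r ≤ maxAvg f x R :=
  le_iSup₂ (f := fun r (_ : r ∈ Set.Ioc 0 R) => ballAvg f x r) r ⟨hr, hrR⟩

lemma minAvg_le_ballAvg (hr : 0 < r) (hrR : r ≤ R) : minAvg f x R ≤ ballAvg f x r :=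
  iInf₂_le (f := fun r (_ : r ∈ Set.Ioc 0 R) => ballAvg f x r) r ⟨hr, hrR⟩

lemma maxAvg_mono (f : EuclideanSpace ℝ (Fin d) → ℝ) (x : EuclideanSpace ℝ (Fin d)) :
    Monotone (maxAvg f x) :=
  fun _ _ h => iSup₂_le fun _ hr => ballAvg_le_maxAvg hr.1 (hr.2.trans h)

lemma minAvg_anti (f : EuclideanSpace ℝ (Fin d) → ℝ) (x : EuclideanSpace ℝ (Fin d)) :
    Antitone (minAvg f x) :=
  fun _ _ h => le_iInf₂ fun _ hr => minAvg_le_ballAvg hr.1 (hr.2.trans h)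

lemma ae_le_maxAvg (hd : 0 < d) (hf : AEMeasurable f volume) [IsFiniteMeasure (law f)]
    (hR : 0 < R) : ∀ᵐ x, ENNReal.ofReal (f x) ≤ maxAvg f x R := by
  filter_upwards [ae_tendsto_ballAvg hd hf] with x hx
  refine le_of_tendsto hx ?_
  filter_upwards [Ioc_mem_nhdsGT hR] with r hr using ballAvg_le_maxAvg hr.1 hr.2

lemma ae_minAvg_le (hd : 0 < d) (hf : AEMeasurable f volume) [IsFiniteMeasure (law f)]
    (hR : 0 < R) : ∀ᵐ x, minAvg f x R ≤ ENNReal.ofReal (f x) := by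
  filter_upwards [ae_tendsto_ballAvg hd hf] with x hx
  refine ge_of_tendsto hx ?_
  filter_upwards [Ioc_mem_nhdsGT hR] with r hr using minAvg_le_ballAvg hr.1 hr.2

end BallAverages

section Moments

variable {d : ℕ} {f : EuclideanSpace ℝ (Fin d) → ℝ} {ε δ R S : ℝ}

lemma rpow_le_one_add_rpow (x : ℝ≥0∞) {a b : ℝ} (ha : 0 ≤ a) (hab : a ≤ b) :
    x ^ a ≤ 1 + x ^ b := by
  rcases le_total x 1 with h | h
  · exact (ENNReal.rpow_le_one h ha).trans le_self_add
  · exact (ENNReal.rpow_le_rpow_of_exponent_le h hab).trans le_add_self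

lemma lintegral_rpow_lt_top_of_le {α : Type*} [MeasurableSpace α] {μ : Measure α}
    [IsFiniteMeasure μ] {g h : α → ℝ≥0∞} (hgh : ∀ x, g x ≤ h x) {a b : ℝ} (ha : 0 ≤ a)
    (hab : a ≤ b) (hh : ∫⁻ x, h x ^ b ∂μ < ∞) : ∫⁻ x, g x ^ a ∂μ < ∞ := by
  calc ∫⁻ x, g x ^ a ∂μ ≤ ∫⁻ x, 1 + h x ^ b ∂μ := lintegral_mono fun x =>
        (ENNReal.rpow_le_rpow (hgh x) ha).trans (rpow_le_one_add_rpow _ ha hab)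
    _ = μ Set.univ + ∫⁻ x, h x ^ b ∂μ := by
        rw [lintegral_add_left measurable_const, lintegral_one]
    _ < ∞ := ENNReal.add_lt_top.2 ⟨measure_lt_top _ _, hh⟩

lemma lintegral_maxAvg_lt_top (hf : AEMeasurable f volume) [IsFiniteMeasure (law f)]
    (hQ : Q f δ S < ∞) (hε : 0 ≤ ε) (h : ε ≤ δ) (hR : R ≤ S) :
    ∫⁻ x, maxAvg f x R ^ ε ∂law f < ∞ :=
  lintegral_rpow_lt_top_of_le (fun x => maxAvg_mono f x hR) hε h (by rwa [lintegral_law hf])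

lemma lintegral_minAvg_lt_top (hf : AEMeasurable f volume) [IsFiniteMeasure (law f)]
    (hT : T f δ S < ∞) (hε : 0 ≤ ε) (h : ε ≤ δ) (hR : R ≤ S) :
    ∫⁻ x, minAvg f x R ^ (-ε) ∂law f < ∞ := by
  have := lintegral_rpow_lt_top_of_le (μ := law f)
    (fun x => ENNReal.inv_le_inv.2 (minAvg_anti f x hR)) hε h
    (by simpa only [ENNReal.inv_rpow, ← ENNReal.rpow_neg, lintegral_law hf, T] using hT)
  simpa only [ENNReal.inv_rpow, ← ENNReal.rpow_neg] using this

lemma abs_log_le_rpow_add_rpow_neg {a : ℝ} (ha : 0 < a) (hε : 0 < ε) :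
    |Real.log a| ≤ (a ^ ε + a ^ (-ε)) / ε := by
  have hupper := Real.log_le_rpow_div ha.le hε
  have hlower := Real.log_le_rpow_div (inv_pos.2 ha).le hε
  rw [Real.log_inv, Real.inv_rpow ha.le, ← Real.rpow_neg ha.le] at hlower
  have : 0 ≤ a ^ ε / ε := by positivity
  have : 0 ≤ a ^ (-ε) / ε := by positivity
  rw [add_div, abs_le]
  constructor <;> linarith

lemma ofReal_abs_log_le {a : ℝ} (ha : 0 < a) (hε : 0 < ε) :
    ENNReal.ofReal |Real.log a| ≤ ENNReal.ofReal ε⁻¹ *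
      (ENNReal.ofReal a ^ ε + ENNReal.ofReal a ^ (-ε)) := by
  rw [ENNReal.ofReal_rpow_of_pos ha, ENNReal.ofReal_rpow_of_pos ha,
    ← ENNReal.ofReal_add (by positivity) (by positivity), ← ENNReal.ofReal_mul (by positivity),
    ← div_eq_inv_mul]
  exact ENNReal.ofReal_le_ofReal (abs_log_le_rpow_add_rpow_neg ha hε)

lemma integrable_log_law (hd : 0 < d) (hf : AEMeasurable f volume) [IsFiniteMeasure (law f)]
    (hε : 0 < ε) (hR : 0 < R) (hQ : ∫⁻ x, maxAvg f x R ^ ε ∂law f < ∞)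
    (hT : ∫⁻ x, minAvg f x R ^ (-ε) ∂law f < ∞) :
    Integrable (fun x => Real.log (f x)) (law f) := by
  have hfm := aemeasurable_law hf
  refine ⟨(Real.measurable_log.comp_aemeasurable hfm).aestronglyMeasurable, ?_⟩
  rw [hasFiniteIntegral_iff_norm]
  calc ∫⁻ x, ENNReal.ofReal ‖Real.log (f x)‖ ∂law f
      ≤ ∫⁻ x, ENNReal.ofReal ε⁻¹ *
        (ENNReal.ofReal (f x) ^ ε + ENNReal.ofReal (f x) ^ (-ε)) ∂law f := by
        refine lintegral_mono_ae ?_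
        filter_upwards [ae_law_pos hf] with x hx using ofReal_abs_log_le hx hε
    _ = ENNReal.ofReal ε⁻¹ * (∫⁻ x, ENNReal.ofReal (f x) ^ ε ∂law f
          + ∫⁻ x, ENNReal.ofReal (f x) ^ (-ε) ∂law f) := by
        rw [lintegral_const_mul' _ _ ENNReal.ofReal_ne_top,
          lintegral_add_left' (hfm.ennreal_ofReal.pow_const _)]
    _ ≤ ENNReal.ofReal ε⁻¹ * (∫⁻ x, maxAvg f x R ^ ε ∂law f
          + ∫⁻ x, minAvg f x R ^ (-ε) ∂law f) := by
        gcongr ENNReal.ofReal ε⁻¹ * (?_ + ?_)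
        · refine lintegral_mono_ae ?_
          filter_upwards [ae_law_of_ae (ae_le_maxAvg hd hf hR)] with x hx
          exact ENNReal.rpow_le_rpow hx hε.le
        · refine lintegral_mono_ae ?_
          filter_upwards [ae_law_of_ae (ae_minAvg_le hd hf hR)] with x hx
          rw [ENNReal.rpow_neg, ENNReal.rpow_neg, ENNReal.inv_le_inv]
          exact ENNReal.rpow_le_rpow hx hε.le
    _ < ∞ := ENNReal.mul_lt_top ENNReal.ofReal_lt_top (ENNReal.add_lt_top.2 ⟨hQ, hT⟩)

end Moments

section NormalizedVolumes

variable {d : ℕ} {f : EuclideanSpace ℝ (Fin d) → ℝ} {x y : EuclideanSpace ℝ (Fin d)} {r R : ℝ}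

/-- The logarithm of `m + 1` times the volume of a ball of radius `r`: the normalization for a
sample of `m + 2` points, where a point has `m + 1` possible neighbours. -/
def logVol (d m : ℕ) (r : ℝ) : ℝ := Real.log ((m + 1) * (r ^ d * unitBallVol d))

/-- The radius of a ball of volume `exp s / (m + 1)`, which inverts `logVol d m`. -/
def radius (d m : ℕ) (s : ℝ) : ℝ := (Real.exp s / ((m + 1) * unitBallVol d)) ^ ((d : ℝ)⁻¹)

lemma measurable_logVol (d m : ℕ) : Measurable (logVol d m) := by
  unfold logVol
  fun_prop

lemma radius_pos (d m : ℕ) (s : ℝ) : 0 < radius d m s := by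
  have := unitBallVol_pos d
  exact Real.rpow_pos_of_pos (by positivity) _

lemma mul_radius_pow (hd : 0 < d) (m : ℕ) (s : ℝ) :
    ((m : ℝ) + 1) * (radius d m s ^ d * unitBallVol d) = Real.exp s := by
  have hV := unitBallVol_pos d
  rw [radius, Real.rpow_inv_natCast_pow (by positivity) hd.ne']
  field_simp

lemma lt_logVol_iff (hd : 0 < d) (m : ℕ) (s : ℝ) (hr : 0 < r) :
    s < logVol d m r ↔ radius d m s < r := by
  have hV := unitBallVol_pos d
  rw [logVol, Real.lt_log_iff_exp_lt (by positivity), ← mul_radius_pow hd m s,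
    mul_lt_mul_iff_right₀ (by positivity), mul_lt_mul_iff_left₀ hV,
    pow_lt_pow_iff_left₀ (radius_pos d m s).le hr.le hd.ne']

lemma tendsto_radius (hd : 0 < d) (s : ℝ) :
    Tendsto (fun m => radius d m s) atTop (𝓝[>] 0) := by
  refine tendsto_nhdsWithin_iff.2 ⟨?_, Eventually.of_forall fun m => radius_pos d m s⟩
  have hvol : Tendsto (fun m : ℕ => Real.exp s / (((m : ℝ) + 1) * unitBallVol d)) atTop (𝓝 0) :=
    tendsto_const_nhds.div_atTop (Tendsto.atTop_mul_const (unitBallVol_pos d)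
      (tendsto_atTop_add_const_right _ _ tendsto_natCast_atTop_atTop))
  have hroot := hvol.rpow_const (p := (d : ℝ)⁻¹) (Or.inr (by positivity))
  rwa [Real.zero_rpow (by positivity)] at hroot

lemma mul_law_closedBall_radius (hd : 0 < d) (m : ℕ) (s : ℝ) :
    ((m : ℝ≥0∞) + 1) * law f (Metric.closedBall x (radius d m s))
      = ENNReal.ofReal (Real.exp s) * ballAvg f x (radius d m s) := by
  rw [law_closedBall_eq f x (radius_pos d m s), ← mul_assoc, ← mul_radius_pow hd m s,
    ENNReal.ofReal_mul (by positivity : (0 : ℝ) ≤ m + 1)]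
  norm_cast

lemma tendsto_mul_law_closedBall_radius (hd : 0 < d) (s : ℝ)
    (hx : Tendsto (ballAvg f x) (𝓝[>] 0) (𝓝 (ENNReal.ofReal (f x)))) :
    Tendsto (fun m : ℕ => ((m : ℝ≥0∞) + 1) * law f (Metric.closedBall x (radius d m s))) atTop
      (𝓝 (ENNReal.ofReal (Real.exp s * f x))) := by
  simp only [mul_law_closedBall_radius hd, ENNReal.ofReal_mul (Real.exp_pos s).le]
  exact ENNReal.Tendsto.const_mul (hx.comp (tendsto_radius hd s)) (Or.inr ENNReal.ofReal_ne_top)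

end NormalizedVolumes

section SurvivalProbabilities

variable {d : ℕ} {f : EuclideanSpace ℝ (Fin d) → ℝ} [IsProbabilityMeasure (law f)]
  {x y : EuclideanSpace ℝ (Fin d)} {ε R : ℝ}

lemma ae_nnDist_pos (hd : 0 < d) (m : ℕ) :
    ∀ᵐ x ∂Measure.pi (fun _ : Fin (m + 2) => law f), ∀ i, 0 < nnDist x i := by
  refine ae_all_iff.2 fun i =>
    (mem_ae_iff_prob_eq_one (measurableSet_lt measurable_const (measurable_nnDist i))).2 ?_
  have hpoint (x : EuclideanSpace ℝ (Fin d)) : law f (Metric.closedBall x 0)ᶜ = 1 := by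
    rw [prob_compl_eq_one_iff Metric.isClosed_closedBall.measurableSet, Metric.closedBall_zero]
    exact law_singleton hd x
  exact (pi_lt_nnDist (law f) m i 0).trans
    (by simp only [hpoint, one_pow, lintegral_one, measure_univ])

lemma ae_lt_logVol_min_iff (hd : 0 < d) (m : ℕ) (hR : 0 < R) (s : ℝ) :
    ∀ᵐ x ∂Measure.pi (fun _ : Fin (m + 2) => law f), ∀ i,
      s < logVol d m (min (nnDist x i) R) ↔ radius d m s < nnDist x i ∧ radius d m s < R := by
  filter_upwards [ae_nnDist_pos hd m] with x hx i
  rw [lt_logVol_iff hd m s (lt_min (hx i) hR), lt_min_iff]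

lemma pi_lt_logVol_min (hd : 0 < d) (m : ℕ) (i : Fin (m + 2)) (hR : 0 < R) (s : ℝ) :
    Measure.pi (fun _ : Fin (m + 2) => law f) {x | s < logVol d m (min (nnDist x i) R)}
      = if radius d m s < R then
          ∫⁻ x, law f (Metric.closedBall x (radius d m s))ᶜ ^ (m + 1) ∂law f else 0 := by
  rw [← pi_lt_nnDist (law f) m i]
  split_ifs with h
  · refine measure_congr ?_
    filter_upwards [ae_lt_logVol_min_iff hd m hR s] with x hx
    exact propext ((hx i).trans (and_iff_left h))
  · refine measure_eq_zero_iff_ae_notMem.2 ?_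
    filter_upwards [ae_lt_logVol_min_iff hd m hR s] with x hx hmem
    exact h ((hx i).1 hmem).2

lemma pi_lt_logVol_min_and_lt_logVol_min (hd : 0 < d) (m : ℕ) {i j : Fin (m + 2)} (hij : i ≠ j)
    (hR : 0 < R) (s : ℝ) :
    Measure.pi (fun _ : Fin (m + 2) => law f)
        {x | s < logVol d m (min (nnDist x i) R) ∧ s < logVol d m (min (nnDist x j) R)}
      = if radius d m s < R then ∫⁻ p in {p | radius d m s < dist p.1 p.2},
          law f (Metric.closedBall p.1 (radius d m s) ∪ Metric.closedBall p.2 (radius d m s))ᶜ ^ m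
          ∂(law f).prod (law f) else 0 := by
  rw [← pi_lt_nnDist_and_lt_nnDist (law f) m hij]
  split_ifs with h
  · refine measure_congr ?_
    filter_upwards [ae_lt_logVol_min_iff hd m hR s] with x hx
    exact propext (and_congr ((hx i).trans (and_iff_left h)) ((hx j).trans (and_iff_left h)))
  · refine measure_eq_zero_iff_ae_notMem.2 ?_
    filter_upwards [ae_lt_logVol_min_iff hd m hR s] with x hx hmem
    exact h ((hx i).1 hmem.1).2

lemma pi_lt_logVol_min_le (hd : 0 < d) (m : ℕ) (i : Fin (m + 2)) (hε : 0 ≤ ε) (hε1 : ε ≤ 1)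
    (hR : 0 < R) (s : ℝ) :
    Measure.pi (fun _ : Fin (m + 2) => law f) {x | s < logVol d m (min (nnDist x i) R)}
      ≤ ENNReal.ofReal (Real.exp (-(ε * s))) * ∫⁻ x, minAvg f x R ^ (-ε) ∂law f := by
  rw [pi_lt_logVol_min hd m i hR]
  split_ifs with h
  swap
  · exact zero_le
  rw [← lintegral_const_mul' _ _ ENNReal.ofReal_ne_top]
  refine lintegral_mono fun x => ?_
  calc law f (Metric.closedBall x (radius d m s))ᶜ ^ (m + 1)
      ≤ ((m + 1 : ℕ) * law f (Metric.closedBall x (radius d m s))) ^ (-ε) :=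
        pow_le_rpow_neg (prob_add_prob_compl Metric.isClosed_closedBall.measurableSet) _ hε hε1
    _ = (ENNReal.ofReal (Real.exp s) * ballAvg f x (radius d m s)) ^ (-ε) := by
        rw [← mul_law_closedBall_radius hd, Nat.cast_add_one]
    _ ≤ (ENNReal.ofReal (Real.exp s) * minAvg f x R) ^ (-ε) := by
        rw [ENNReal.rpow_neg, ENNReal.rpow_neg, ENNReal.inv_le_inv]
        gcongr
        exact minAvg_le_ballAvg (radius_pos d m s) h.le
    _ = ENNReal.ofReal (Real.exp (-(ε * s))) * minAvg f x R ^ (-ε) := by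
        rw [ENNReal.rpow_neg, ENNReal.mul_rpow_of_nonneg _ _ hε, ENNReal.rpow_neg,
          ofReal_exp_rpow s hε, ENNReal.mul_inv (Or.inl (by simp [Real.exp_pos]))
            (Or.inl (by simp)), ← ENNReal.ofReal_inv_of_pos (Real.exp_pos _), Real.exp_neg]

lemma one_le_pi_lt_logVol_min_add (hd : 0 < d) (m : ℕ) (i : Fin (m + 2)) (hε : 0 < ε)
    (hε1 : ε ≤ 1) (hR : 0 < R) (hm : 0 ≤ logVol d m R) (s : ℝ) :
    1 ≤ Measure.pi (fun _ : Fin (m + 2) => law f) {x | s < logVol d m (min (nnDist x i) R)}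
      + ENNReal.ofReal (Real.exp (ε * s)) * max 1 (∫⁻ x, maxAvg f x R ^ ε ∂law f) := by
  rw [pi_lt_logVol_min hd m i hR]
  split_ifs with h
  · have hball (x : EuclideanSpace ℝ (Fin d)) :
        1 ≤ law f (Metric.closedBall x (radius d m s))ᶜ ^ (m + 1)
          + ENNReal.ofReal (Real.exp (ε * s)) * maxAvg f x R ^ ε := calc
      1 ≤ law f (Metric.closedBall x (radius d m s))ᶜ ^ (m + 1)
          + ((m + 1 : ℕ) * law f (Metric.closedBall x (radius d m s))) ^ ε :=
        one_le_pow_add_rpow (prob_add_prob_compl Metric.isClosed_closedBall.measurableSet) _ hε hε1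
      _ = law f (Metric.closedBall x (radius d m s))ᶜ ^ (m + 1)
          + ENNReal.ofReal (Real.exp (ε * s)) * ballAvg f x (radius d m s) ^ ε := by
        rw [Nat.cast_add_one, mul_law_closedBall_radius hd, ENNReal.mul_rpow_of_nonneg _ _ hε.le,
          ofReal_exp_rpow s hε.le]
      _ ≤ _ := by
        gcongr
        exact ballAvg_le_maxAvg (radius_pos d m s) h.le
    calc (1 : ℝ≥0∞)
        = ∫⁻ _, 1 ∂law f := by simp only [lintegral_one, measure_univ]
      _ ≤ _ := lintegral_mono hball
      _ = _ := lintegral_add_left ((measurable_measure_compl_closedBall _ _).pow_const _) _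
      _ ≤ _ := by
        rw [lintegral_const_mul' _ _ ENNReal.ofReal_ne_top]
        gcongr
        exact le_max_right _ _
  · have hs : 0 ≤ s := hm.trans (not_lt.1 (mt (lt_logVol_iff hd m s hR).1 h))
    rw [zero_add]
    refine one_le_mul ?_ (le_max_left _ _)
    rw [ENNReal.one_le_ofReal, Real.one_le_exp_iff]
    positivity

lemma tendsto_lintegral_law_compl_closedBall_pow (hd : 0 < d) (hf : AEMeasurable f volume)
    (hf0 : ∀ x, 0 ≤ f x) (s : ℝ) :
    Tendsto (fun m => ∫⁻ x, law f (Metric.closedBall x (radius d m s))ᶜ ^ (m + 1) ∂law f) atTop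
      (𝓝 (∫⁻ x, ENNReal.ofReal (Real.exp (-(Real.exp s * f x))) ∂law f)) := by
  refine tendsto_lintegral_of_dominated_convergence' 1 (fun m => ?_)
    (fun m => ae_of_all _ fun x => pow_le_one' prob_le_one _)
    (by simp only [Pi.one_apply, lintegral_one, measure_ne_top, ne_eq, not_false_eq_true]) ?_
  · exact ((measurable_measure_compl_closedBall _ _).pow_const _).aemeasurable
  · filter_upwards [ae_law_of_ae (ae_tendsto_ballAvg hd hf)] with x hx
    exact tendsto_pow_ofReal_exp_neg
      (fun m => prob_add_prob_compl Metric.isClosed_closedBall.measurableSet)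
      (mul_nonneg (Real.exp_pos s).le (hf0 x)) (tendsto_mul_law_closedBall_radius hd s hx) 1

lemma tendsto_law_compl_closedBall_union_pow (hd : 0 < d) (s : ℝ) (hf0 : ∀ x, 0 ≤ f x)
    (hxy : x ≠ y) (hx : Tendsto (ballAvg f x) (𝓝[>] 0) (𝓝 (ENNReal.ofReal (f x))))
    (hy : Tendsto (ballAvg f y) (𝓝[>] 0) (𝓝 (ENNReal.ofReal (f y)))) :
    Tendsto (fun m => law f
        (Metric.closedBall x (radius d m s) ∪ Metric.closedBall y (radius d m s))ᶜ ^ m) atTop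
      (𝓝 (ENNReal.ofReal (Real.exp (-(Real.exp s * f x)))
        * ENNReal.ofReal (Real.exp (-(Real.exp s * f y))))) := by
  have hexp := Real.exp_pos s
  rw [← ENNReal.ofReal_mul (Real.exp_pos _).le, ← Real.exp_add, ← neg_add]
  refine tendsto_pow_ofReal_exp_neg (k := 0) (fun m => prob_add_prob_compl
      (Metric.isClosed_closedBall.union Metric.isClosed_closedBall).measurableSet)
    (add_nonneg (mul_nonneg hexp.le (hf0 x)) (mul_nonneg hexp.le (hf0 y))) ?_
  rw [ENNReal.ofReal_add (mul_nonneg hexp.le (hf0 x)) (mul_nonneg hexp.le (hf0 y))]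
  refine ((tendsto_mul_law_closedBall_radius hd s hx).add
    (tendsto_mul_law_closedBall_radius hd s hy)).congr' ?_
  have hsmall := (tendsto_nhdsWithin_iff.1 (tendsto_radius hd s)).1.eventually_lt_const
    (half_pos (dist_pos.2 hxy))
  filter_upwards [hsmall] with m hm
  rw [measure_union (Metric.closedBall_disjoint_closedBall (by linarith))
    Metric.isClosed_closedBall.measurableSet, mul_add]

lemma tendsto_setLIntegral_law_compl_closedBall_union_pow (hd : 0 < d)
    (hf : AEMeasurable f volume) (hf0 : ∀ x, 0 ≤ f x) (s : ℝ) :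
    Tendsto (fun m => ∫⁻ p in {p | radius d m s < dist p.1 p.2},
        law f (Metric.closedBall p.1 (radius d m s) ∪ Metric.closedBall p.2 (radius d m s))ᶜ ^ m
        ∂(law f).prod (law f)) atTop
      (𝓝 ((∫⁻ x, ENNReal.ofReal (Real.exp (-(Real.exp s * f x))) ∂law f) ^ 2)) := by
  have hS (m : ℕ) : MeasurableSet {p : EuclideanSpace ℝ (Fin d) × EuclideanSpace ℝ (Fin d) |
      radius d m s < dist p.1 p.2} := measurableSet_lt measurable_const (by fun_prop)
  have hg : AEMeasurable (fun x => ENNReal.ofReal (Real.exp (-(Real.exp s * f x)))) (law f) := by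
    have := aemeasurable_law hf
    fun_prop
  rw [sq, ← lintegral_prod_mul hg hg]
  simp only [← lintegral_indicator (hS _)]
  refine tendsto_lintegral_of_dominated_convergence' 1 (fun m => ?_) (fun m => ?_) ?_ ?_
  · exact (((measurable_measure_compl_closedBall_union _ _).pow_const _).indicator
      (hS m)).aemeasurable
  · exact ae_of_all _ fun p => (Set.indicator_le_self _ _ p).trans (pow_le_one' prob_le_one _)
  · simp only [Pi.one_apply, lintegral_one, measure_ne_top, ne_eq, not_false_eq_true]
  · have hball := ae_law_of_ae (f := f) (ae_tendsto_ballAvg hd hf)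
    filter_upwards [ae_prod_law_ne hd, Measure.quasiMeasurePreserving_fst.ae hball,
      Measure.quasiMeasurePreserving_snd.ae hball] with p hp hx hy
    refine (tendsto_law_compl_closedBall_union_pow hd s hf0 hp hx hy).congr' ?_
    have hsmall := (tendsto_nhdsWithin_iff.1 (tendsto_radius hd s)).1.eventually_lt_const
      (dist_pos.2 hp)
    filter_upwards [hsmall] with m hm
    simp only [Set.indicator_apply, Set.mem_ofPred_eq, hm, if_true]

end SurvivalProbabilities

section ExponentialLaw

lemma expMeasure_one_eq : expMeasure 1
    = (volume.restrict (Set.Ioi 0)).withDensity fun t => ENNReal.ofReal (Real.exp (-t)) := by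
  have hpdf : exponentialPDF 1
      = (Set.Ici 0).indicator fun t => ENNReal.ofReal (Real.exp (-t)) := by
    ext t
    by_cases ht : 0 ≤ t <;> simp [exponentialPDF_eq, ht]
  rw [Measure.restrict_congr_set Ioi_ae_eq_Ici, ← withDensity_indicator measurableSet_Ici, ← hpdf]
  rfl

lemma expMeasure_one_Ioi {b : ℝ} (hb : 0 ≤ b) :
    expMeasure 1 (Set.Ioi b) = ENNReal.ofReal (Real.exp (-b)) := by
  rw [expMeasure_one_eq, withDensity_apply _ measurableSet_Ioi,
    Measure.restrict_restrict measurableSet_Ioi, Set.inter_eq_left.2 (Set.Ioi_subset_Ioi hb),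
    ← ofReal_integral_eq_lintegral_ofReal
      (by simpa [IntegrableOn] using exp_neg_integrableOn_Ioi b one_pos)
      (ae_of_all _ fun t => (Real.exp_pos _).le), integral_exp_neg_Ioi]

lemma ae_expMeasure_one_pos : ∀ᵐ t ∂expMeasure 1, 0 < t := by
  rw [expMeasure_one_eq]
  exact (withDensity_absolutelyContinuous _ _).ae_le (ae_restrict_mem measurableSet_Ioi)

lemma integrableOn_log_mul_exp_neg :
    IntegrableOn (fun t => Real.log t * Real.exp (-t)) (Set.Ioi 0) := by
  have hΓ := ((Real.GammaIntegral_convergent (s := 3 / 2) (by norm_num)).add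
    (Real.GammaIntegral_convergent (s := 1 / 2) (by norm_num))).const_mul 2
  refine Integrable.mono' hΓ (by fun_prop) ?_
  filter_upwards [ae_restrict_mem measurableSet_Ioi] with t ht
  have hlog := abs_log_le_rpow_add_rpow_neg (a := t) (ε := 1 / 2) ht (by norm_num)
  rw [norm_mul, Real.norm_eq_abs, Real.norm_of_nonneg (Real.exp_pos _).le]
  refine (mul_le_mul_of_nonneg_right hlog (Real.exp_pos _).le).trans_eq ?_
  simp only [Pi.add_apply]
  norm_num
  ring

lemma integrable_log_expMeasure_one : Integrable Real.log (expMeasure 1) := by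
  rw [expMeasure_one_eq, integrable_withDensity_iff_integrable_smul₀' (by fun_prop) (by simp)]
  simpa [ENNReal.toReal_ofReal (Real.exp_pos _).le, mul_comm, IntegrableOn] using
    integrableOn_log_mul_exp_neg

lemma integral_log_expMeasure_one :
    ∫ t, Real.log t ∂expMeasure 1 = -Real.eulerMascheroniConstant := by
  rw [expMeasure_one_eq, integral_withDensity_eq_integral_toReal_smul₀ (by fun_prop) (by simp)]
  have hΓ : HasDerivAt Complex.GammaIntegral (-(Real.eulerMascheroniConstant : ℂ)) 1 := by
    refine Complex.hasDerivAt_Gamma_one.congr_of_eventuallyEq ?_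
    have hre : {z : ℂ | 0 < z.re} ∈ 𝓝 (1 : ℂ) :=
      (isOpen_lt continuous_const Complex.continuous_re).mem_nhds (by simp)
    filter_upwards [hre] with z hz using (Complex.Gamma_eq_integral hz).symm
  have hderiv := (Complex.hasDerivAt_GammaIntegral (s := 1) (by simp)).unique hΓ
  simp only [sub_self, Complex.cpow_zero, one_mul, ← Complex.ofReal_mul, ← Complex.ofReal_neg,
    integral_complex_ofReal] at hderiv
  rw [← Complex.ofReal_inj.1 hderiv]
  simp [ENNReal.toReal_ofReal (Real.exp_pos _).le, mul_comm]

instance : IsProbabilityMeasure (expMeasure 1) := isProbabilityMeasure_expMeasure one_pos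

end ExponentialLaw

section LimitLaw

variable {d : ℕ} {f : EuclideanSpace ℝ (Fin d) → ℝ}

/-- The law of a pair `(ξ, τ)`, where `ξ` has density `f` and `τ` is an independent standard
exponential variable. The normalized volume of the nearest-neighbour ball of a sample point
converges in law to `τ / f ξ`. -/
abbrev limitLaw (f : EuclideanSpace ℝ (Fin d) → ℝ) : Measure (EuclideanSpace ℝ (Fin d) × ℝ) :=
  (law f).prod (expMeasure 1)

lemma limitLaw_lt_log_sub_log (hf : AEMeasurable f volume) (s : ℝ) :
    limitLaw f {p | s < Real.log p.2 - Real.log (f p.1)}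
      = ∫⁻ x, ENNReal.ofReal (Real.exp (-(Real.exp s * f x))) ∂law f := by
  have hfst : AEMeasurable (fun p => f p.1) (limitLaw f) :=
    (aemeasurable_law hf).comp_quasiMeasurePreserving Measure.quasiMeasurePreserving_fst
  have hZ : AEMeasurable (fun p => Real.log p.2 - Real.log (f p.1)) (limitLaw f) :=
    (Real.measurable_log.comp measurable_snd).aemeasurable.sub
      (Real.measurable_log.comp_aemeasurable hfst)
  have hS : NullMeasurableSet {p | s < Real.log p.2 - Real.log (f p.1)} (limitLaw f) :=
    nullMeasurableSet_lt aemeasurable_const hZ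
  have hind : AEMeasurable
      ({p | s < Real.log p.2 - Real.log (f p.1)}.indicator
        (1 : EuclideanSpace ℝ (Fin d) × ℝ → ℝ≥0∞)) (limitLaw f) :=
    measurable_one.aemeasurable.indicator₀ hS
  rw [← lintegral_indicator_one₀ hS, lintegral_prod _ hind]
  refine lintegral_congr_ae ?_
  filter_upwards [ae_law_pos hf] with x hx
  rw [← expMeasure_one_Ioi (mul_nonneg (Real.exp_pos s).le hx.le),
    ← lintegral_indicator_one measurableSet_Ioi]
  refine lintegral_congr_ae ?_
  filter_upwards [ae_expMeasure_one_pos] with t ht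
  have hiff : s < Real.log t - Real.log (f x) ↔ Real.exp s * f x < t := by
    rw [← Real.log_div ht.ne' hx.ne', Real.lt_log_iff_exp_lt (div_pos ht hx), lt_div_iff₀ hx]
  simp only [Set.indicator_apply, Set.mem_ofPred_eq, Set.mem_Ioi, hiff, Pi.one_apply]

lemma integrable_log_sub_log_limitLaw [IsFiniteMeasure (law f)]
    (hlog : Integrable (fun x => Real.log (f x)) (law f)) :
    Integrable (fun p => Real.log p.2 - Real.log (f p.1)) (limitLaw f) :=
  (integrable_log_expMeasure_one.comp_snd (law f)).sub (hlog.comp_fst (expMeasure 1))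

lemma integral_log_sub_log_limitLaw [IsProbabilityMeasure (law f)] (hf : AEMeasurable f volume)
    (hf0 : ∀ x, 0 ≤ f x) (hlog : Integrable (fun x => Real.log (f x)) (law f)) :
    ∫ p, (Real.log p.2 - Real.log (f p.1)) ∂limitLaw f
      = entropy f - Real.eulerMascheroniConstant := by
  rw [integral_sub (integrable_log_expMeasure_one.comp_snd (law f)) (hlog.comp_fst (expMeasure 1)),
    integral_fun_snd, integral_fun_fst (fun x => Real.log (f x)), integral_log_expMeasure_one,
    integral_law hf hf0, entropy]
  simp only [probReal_univ, one_smul]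
  ring

end LimitLaw

section TruncatedMean

variable {d : ℕ} {f : EuclideanSpace ℝ (Fin d) → ℝ} [IsProbabilityMeasure (law f)] {ε R : ℝ}

lemma tendsto_pi_lt_logVol_min (hd : 0 < d) (hf : AEMeasurable f volume) (hf0 : ∀ x, 0 ≤ f x)
    (hR : 0 < R) (s : ℝ) :
    Tendsto (fun m => (Measure.pi fun _ : Fin (m + 2) => law f).real
        {x | s < logVol d m (min (nnDist x 0) R)}) atTop
      (𝓝 ((limitLaw f).real {p | s < Real.log p.2 - Real.log (f p.1)})) := by
  refine (ENNReal.tendsto_toReal (measure_ne_top _ _)).comp ?_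
  rw [limitLaw_lt_log_sub_log hf]
  refine (tendsto_lintegral_law_compl_closedBall_pow hd hf hf0 s).congr' ?_
  filter_upwards [(tendsto_nhdsWithin_iff.1 (tendsto_radius hd s)).1.eventually_lt_const hR]
    with m hm
  rw [pi_lt_logVol_min hd m 0 hR, if_pos hm]

lemma tendsto_pi_lt_logVol_min_and_lt_logVol_min (hd : 0 < d) (hf : AEMeasurable f volume)
    (hf0 : ∀ x, 0 ≤ f x) (hR : 0 < R) (s : ℝ) :
    Tendsto (fun m => (Measure.pi fun _ : Fin (m + 2) => law f).real
        {x | s < logVol d m (min (nnDist x 0) R) ∧ s < logVol d m (min (nnDist x 1) R)}) atTop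
      (𝓝 ((limitLaw f).real {p | s < Real.log p.2 - Real.log (f p.1)} ^ 2)) := by
  rw [measureReal_def, ← ENNReal.toReal_pow]
  refine (ENNReal.tendsto_toReal (ENNReal.pow_ne_top (measure_ne_top _ _))).comp ?_
  rw [limitLaw_lt_log_sub_log hf]
  refine (tendsto_setLIntegral_law_compl_closedBall_union_pow hd hf hf0 s).congr' ?_
  filter_upwards [(tendsto_nhdsWithin_iff.1 (tendsto_radius hd s)).1.eventually_lt_const hR]
    with m hm
  rw [pi_lt_logVol_min_and_lt_logVol_min hd m zero_ne_one hR, if_pos hm]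

lemma pi_real_lt_logVol_min_le (hd : 0 < d) (m : ℕ) (i : Fin (m + 2)) (hε : 0 ≤ ε) (hε1 : ε ≤ 1)
    (hR : 0 < R) (hT : ∫⁻ x, minAvg f x R ^ (-ε) ∂law f < ∞) (s : ℝ) :
    (Measure.pi fun _ : Fin (m + 2) => law f).real {x | s < logVol d m (min (nnDist x i) R)}
      ≤ (∫⁻ x, minAvg f x R ^ (-ε) ∂law f).toReal * Real.exp (-(ε * s)) := by
  refine (ENNReal.toReal_mono (ENNReal.mul_ne_top ENNReal.ofReal_ne_top hT.ne)
    (pi_lt_logVol_min_le hd m i hε hε1 hR s)).trans_eq ?_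
  rw [ENNReal.toReal_mul, ENNReal.toReal_ofReal (Real.exp_pos _).le, mul_comm]

lemma one_sub_pi_real_lt_logVol_min_le (hd : 0 < d) (m : ℕ) (i : Fin (m + 2)) (hε : 0 < ε)
    (hε1 : ε ≤ 1) (hR : 0 < R) (hm : 0 ≤ logVol d m R)
    (hQ : ∫⁻ x, maxAvg f x R ^ ε ∂law f < ∞) (s : ℝ) :
    1 - (Measure.pi fun _ : Fin (m + 2) => law f).real {x | s < logVol d m (min (nnDist x i) R)}
      ≤ (max 1 (∫⁻ x, maxAvg f x R ^ ε ∂law f)).toReal * Real.exp (ε * s) := by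
  have hfin : ENNReal.ofReal (Real.exp (ε * s)) * max 1 (∫⁻ x, maxAvg f x R ^ ε ∂law f) ≠ ∞ :=
    ENNReal.mul_ne_top ENNReal.ofReal_ne_top (max_lt ENNReal.one_lt_top hQ).ne
  have hone := ENNReal.toReal_mono (ENNReal.add_ne_top.2 ⟨measure_ne_top _ _, hfin⟩)
    (one_le_pi_lt_logVol_min_add hd m i hε hε1 hR hm s)
  rw [ENNReal.toReal_one, ENNReal.toReal_add (measure_ne_top _ _) hfin, ENNReal.toReal_mul,
    ENNReal.toReal_ofReal (Real.exp_pos _).le, mul_comm (Real.exp _)] at hone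
  exact sub_le_iff_le_add'.2 hone

lemma eventually_logVol_nonneg (hR : 0 < R) : ∀ᶠ m : ℕ in atTop, 0 ≤ logVol d m R := by
  have hv : 0 < R ^ d * unitBallVol d := mul_pos (pow_pos hR d) (unitBallVol_pos d)
  filter_upwards [((tendsto_atTop_add_const_right _ 1 tendsto_natCast_atTop_atTop).atTop_mul_const
    hv).eventually_ge_atTop 1] with m hm using Real.log_nonneg hm

lemma tendsto_lintegral_sq_mean_logVol_min (hd : 0 < d) (hf : AEMeasurable f volume)
    (hf0 : ∀ x, 0 ≤ f x) (hε : 0 < ε) (hε1 : ε ≤ 1) (hR : 0 < R)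
    (hQ : ∫⁻ x, maxAvg f x R ^ ε ∂law f < ∞) (hT : ∫⁻ x, minAvg f x R ^ (-ε) ∂law f < ∞) :
    Tendsto (fun m : ℕ => ∫⁻ x, ENNReal.ofReal
        (((∑ i, logVol d m (min (nnDist x i) R)) / (m + 2 : ℕ)
          - (entropy f - Real.eulerMascheroniConstant)) ^ 2)
        ∂Measure.pi (fun _ : Fin (m + 2) => law f)) atTop (𝓝 0) := by
  have hlog := integrable_log_law hd hf hε hR hQ hT
  set C := max (∫⁻ x, minAvg f x R ^ (-ε) ∂law f).toReal
    (max 1 (∫⁻ x, maxAvg f x R ^ ε ∂law f)).toReal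
  have hmean := tendsto_lintegral_sq_mean_sub_integral
    (P := fun m : ℕ => Measure.pi fun _ : Fin (m + 2) => law f)
    (Y := fun m i x => logVol d m (min (nnDist x i) R))
    (by simpa using tendsto_add_atTop_nat 2)
    (fun m i => (measurable_logVol d m).comp ((measurable_nnDist i).min measurable_const))
    (integrable_log_sub_log_limitLaw hlog)
    (fun m i s => by simp only [measureReal_def, pi_lt_logVol_min hd m _ hR])
    (fun m i j s hij => by
      simp only [measureReal_def, pi_lt_logVol_min_and_lt_logVol_min hd m hij hR,
        pi_lt_logVol_min_and_lt_logVol_min hd m zero_ne_one hR])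
    (tendsto_pi_lt_logVol_min hd hf hf0 hR)
    (tendsto_pi_lt_logVol_min_and_lt_logVol_min hd hf hf0 hR) hε
    (C := C)
    (Eventually.of_forall fun m s => (pi_real_lt_logVol_min_le hd m 0 hε.le hε1 hR hT s).trans
      (mul_le_mul_of_nonneg_right (le_max_left _ _) (Real.exp_pos _).le))
    ((eventually_logVol_nonneg hR).mono fun m hm s =>
      (one_sub_pi_real_lt_logVol_min_le hd m 0 hε hε1 hR hm hQ s).trans
        (mul_le_mul_of_nonneg_right (le_max_right _ _) (Real.exp_pos _).le))
  simpa only [integral_log_sub_log_limitLaw hf hf0 hlog, Fintype.card_fin] using hmean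

end TruncatedMean

section FarNeighbours

variable {d : ℕ} {μ : Measure (EuclideanSpace ℝ (Fin d))} [IsProbabilityMeasure μ] {R : ℝ}

lemma memLp_posLog_dist_div (R : ℝ)
    (hμ : MemLp (fun p : EuclideanSpace ℝ (Fin d) × EuclideanSpace ℝ (Fin d) =>
      Real.posLog (dist p.1 p.2)) 2 (μ.prod μ)) :
    MemLp (fun p : EuclideanSpace ℝ (Fin d) × EuclideanSpace ℝ (Fin d) =>
      Real.posLog (dist p.1 p.2 / R)) 2 (μ.prod μ) := by
  refine (hμ.add (memLp_const (Real.posLog R⁻¹))).mono' (by fun_prop) (ae_of_all _ fun p => ?_)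
  rw [Real.norm_of_nonneg Real.posLog_nonneg, div_eq_mul_inv]
  exact Real.posLog_mul

lemma ae_tendsto_measure_compl_closedBall_pow (hR : 0 < R) :
    ∀ᵐ x ∂μ, Tendsto (fun m : ℕ => μ (Metric.closedBall x R)ᶜ ^ m) atTop (𝓝 0) := by
  filter_upwards [μ.support_mem_ae] with x hx
  rw [ENNReal.tendsto_pow_atTop_nhds_zero_iff]
  have hpos := (Measure.mem_support_iff_forall x).1 hx _ (Metric.closedBall_mem_nhds x hR)
  rw [prob_compl_eq_one_sub Metric.isClosed_closedBall.measurableSet]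
  exact ENNReal.sub_lt_self ENNReal.one_ne_top one_ne_zero hpos.ne'

lemma tendsto_lintegral_sq_posLog_dist_mul (hR : 0 < R)
    (hμ : MemLp (fun p : EuclideanSpace ℝ (Fin d) × EuclideanSpace ℝ (Fin d) =>
      Real.posLog (dist p.1 p.2)) 2 (μ.prod μ)) :
    Tendsto (fun m : ℕ => ∫⁻ p, ENNReal.ofReal (Real.posLog (dist p.1 p.2 / R) ^ 2)
      * μ (Metric.closedBall p.1 R)ᶜ ^ m ∂μ.prod μ) atTop (𝓝 0) := by
  rw [← lintegral_zero (μ := μ.prod μ)]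
  refine tendsto_lintegral_of_dominated_convergence'
    (fun p => ENNReal.ofReal (Real.posLog (dist p.1 p.2 / R) ^ 2)) (fun m => ?_)
    (fun m => ae_of_all _ fun p => mul_le_of_le_one_right' (pow_le_one' prob_le_one _))
    (memLp_posLog_dist_div R hμ).integrable_sq.lintegral_lt_top.ne ?_
  · have hball : Measurable fun p : EuclideanSpace ℝ (Fin d) × EuclideanSpace ℝ (Fin d) =>
        μ (Metric.closedBall p.1 R)ᶜ :=
      (measurable_measure_compl_closedBall μ R).comp measurable_fst
    have hdist : Measurable fun p : EuclideanSpace ℝ (Fin d) × EuclideanSpace ℝ (Fin d) =>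
        Real.posLog (dist p.1 p.2 / R) := by fun_prop
    exact ((hdist.pow_const 2).ennreal_ofReal.mul (hball.pow_const m)).aemeasurable
  · filter_upwards [Measure.quasiMeasurePreserving_fst.ae
      (ae_tendsto_measure_compl_closedBall_pow (μ := μ) hR)] with p hp
    simpa only [mul_zero] using ENNReal.Tendsto.const_mul hp (Or.inr ENNReal.ofReal_ne_top)

lemma lintegral_sq_posLog_nnDist_le (hR : 0 < R) (m : ℕ) (i : Fin (m + 2)) :
    ∫⁻ x, ENNReal.ofReal (Real.posLog (nnDist x i / R) ^ 2) ∂Measure.pi (fun _ => μ)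
      ≤ ∫⁻ p, ENNReal.ofReal (Real.posLog (dist p.1 p.2 / R) ^ 2)
        * μ (Metric.closedBall p.1 R)ᶜ ^ m ∂μ.prod μ := by
  have hmono : MonotoneOn (fun t => ENNReal.ofReal (Real.posLog (t / R) ^ 2)) (Set.Ici 0) := by
    intro t ht u _ htu
    exact ENNReal.ofReal_le_ofReal (pow_le_pow_left₀ Real.posLog_nonneg
      (Real.posLog_le_posLog (div_nonneg ht hR.le) (by gcongr)) 2)
  refine le_of_eq_of_le ?_ (setLIntegral_comp_nnDist_le μ m i (by fun_prop) hmono R)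
  refine (setLIntegral_eq_of_support_subset fun x hx => ?_).symm
  refine (not_le.1 fun hle => hx ?_ : R < nnDist x i)
  have hnn := nnDist_nonneg x i
  simp [Real.posLog_eq_zero_iff, abs_of_nonneg, hnn, hR.le, div_nonneg, (div_le_one hR).2 hle]

lemma tendsto_lintegral_sq_mean_posLog_nnDist (hR : 0 < R)
    (hμ : MemLp (fun p : EuclideanSpace ℝ (Fin d) × EuclideanSpace ℝ (Fin d) =>
      Real.posLog (dist p.1 p.2)) 2 (μ.prod μ)) :
    Tendsto (fun m : ℕ => ∫⁻ x, ENNReal.ofReal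
      (((∑ i, Real.posLog (nnDist x i / R)) / (m + 2 : ℕ)) ^ 2)
      ∂Measure.pi (fun _ : Fin (m + 2) => μ)) atTop (𝓝 0) := by
  refine tendsto_of_tendsto_of_tendsto_of_le_of_le tendsto_const_nhds
    (tendsto_lintegral_sq_posLog_dist_mul hR hμ) (fun _ => zero_le) fun m => ?_
  simpa only [Fintype.card_fin] using lintegral_sq_mean_le
    (Z := fun i x => Real.posLog (nnDist x i / R))
    (fun i => Real.continuous_posLog.measurable.comp ((measurable_nnDist i).div_const R))
    (lintegral_sq_posLog_nnDist_le hR m)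

end FarNeighbours

section MeanSquareConsistency

variable {d : ℕ} {f : EuclideanSpace ℝ (Fin d) → ℝ} {ε R : ℝ}

lemma measurable_klEstimate (N : ℕ) :
    Measurable (klEstimate : (Fin N → EuclideanSpace ℝ (Fin d)) → ℝ) := by
  unfold klEstimate meanNNDist
  have hprod : Measurable fun x : Fin N → EuclideanSpace ℝ (Fin d) => ∏ i, nnDist x i :=
    Finset.measurable_fun_prod _ fun i _ => measurable_nnDist i
  fun_prop

lemma logVol_eq_log_add (m : ℕ) {r : ℝ} (hr : 0 < r) :
    logVol d m r = Real.log ((m : ℝ) + 1) + Real.log (unitBallVol d) + d * Real.log r := by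
  rw [logVol, Real.log_mul (by positivity) (mul_pos (pow_pos hr d) (unitBallVol_pos d)).ne',
    Real.log_mul (by positivity) (unitBallVol_pos d).ne', Real.log_pow]
  ring

lemma logVol_eq_logVol_min_add (m : ℕ) {r : ℝ} (hr : 0 < r) (hR : 0 < R) :
    logVol d m r = logVol d m (min r R) + d * Real.posLog (r / R) := by
  rcases le_total r R with h | h
  · have hdiv : Real.posLog (r / R) = 0 := by
      rw [Real.posLog_eq_zero_iff, abs_of_pos (div_pos hr hR)]
      exact (div_le_one hR).2 h
    rw [min_eq_left h, hdiv, mul_zero, add_zero]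
  · have hdiv : 1 ≤ |r / R| := by
      rw [abs_of_pos (div_pos hr hR)]
      exact (one_le_div hR).2 h
    rw [min_eq_right h, Real.posLog_eq_log hdiv, Real.log_div hr.ne' hR.ne',
      logVol_eq_log_add m hr, logVol_eq_log_add m hR]
    ring

lemma klEstimate_eq_mean_logVol {m : ℕ} {x : Fin (m + 2) → EuclideanSpace ℝ (Fin d)}
    (hx : ∀ i, 0 < nnDist x i) :
    klEstimate x = (∑ i, logVol d m (nnDist x i)) / (m + 2 : ℕ)
      + Real.eulerMascheroniConstant := by
  simp only [logVol_eq_log_add m (hx _), Finset.sum_add_distrib, ← Finset.mul_sum,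
    ← Real.log_prod fun i _ => (hx i).ne', Finset.sum_const, Finset.card_univ, Fintype.card_fin,
    nsmul_eq_mul]
  rw [klEstimate, meanNNDist, Real.log_rpow (Finset.prod_pos fun i _ => hx i)]
  push_cast
  rw [show (m : ℝ) + 2 - 1 = m + 1 by ring]
  field_simp
  ring

lemma klEstimate_sub_eq {m : ℕ} {x : Fin (m + 2) → EuclideanSpace ℝ (Fin d)}
    (hx : ∀ i, 0 < nnDist x i) (hR : 0 < R) (h : ℝ) :
    klEstimate x - h = d * ((∑ i, Real.posLog (nnDist x i / R)) / (m + 2 : ℕ))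
      + ((∑ i, logVol d m (min (nnDist x i) R)) / (m + 2 : ℕ)
        - (h - Real.eulerMascheroniConstant)) := by
  rw [klEstimate_eq_mean_logVol hx]
  simp only [logVol_eq_logVol_min_add m (hx _) hR, Finset.sum_add_distrib, ← Finset.mul_sum]
  ring

theorem tendsto_lintegral_sq_klEstimate_sub_entropy [IsProbabilityMeasure (law f)] (hd : 0 < d)
    (hf : AEMeasurable f volume) (hf0 : ∀ x, 0 ≤ f x) (hε : 0 < ε) (hε1 : ε ≤ 1) (hR : 0 < R)
    (hdist : MemLp (fun p : EuclideanSpace ℝ (Fin d) × EuclideanSpace ℝ (Fin d) =>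
      Real.posLog (dist p.1 p.2)) 2 ((law f).prod (law f)))
    (hQ : ∫⁻ x, maxAvg f x R ^ ε ∂law f < ∞) (hT : ∫⁻ x, minAvg f x R ^ (-ε) ∂law f < ∞) :
    Tendsto (fun m : ℕ => ∫⁻ x, ENNReal.ofReal ((klEstimate x - entropy f) ^ 2)
      ∂Measure.pi (fun _ : Fin (m + 2) => law f)) atTop (𝓝 0) := by
  have hnear := tendsto_lintegral_sq_mean_logVol_min hd hf hf0 hε hε1 hR hQ hT
  have hfar := tendsto_lintegral_sq_mean_posLog_nnDist hR hdist
  have hsum := (ENNReal.Tendsto.const_mul (a := ENNReal.ofReal (2 * d ^ 2)) hfar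
    (Or.inr ENNReal.ofReal_ne_top)).add
      (ENNReal.Tendsto.const_mul (a := 2) hnear (Or.inr ENNReal.ofNat_ne_top))
  simp only [mul_zero, add_zero] at hsum
  refine tendsto_of_tendsto_of_tendsto_of_le_of_le tendsto_const_nhds hsum (fun _ => zero_le)
    fun m => ?_
  have hposLog : Measurable fun x : Fin (m + 2) → EuclideanSpace ℝ (Fin d) => ENNReal.ofReal
      (((∑ i, Real.posLog (nnDist x i / R)) / (m + 2 : ℕ)) ^ 2) :=
    (((Finset.measurable_fun_sum _ fun i _ => Real.continuous_posLog.measurable.comp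
      ((measurable_nnDist i).div_const R)).div_const _).pow_const 2).ennreal_ofReal
  beta_reduce
  rw [← lintegral_const_mul _ hposLog, ← lintegral_const_mul' _ _ ENNReal.ofNat_ne_top,
    ← lintegral_add_left (hposLog.const_mul _)]
  refine lintegral_mono_ae ?_
  filter_upwards [ae_nnDist_pos hd m] with x hx
  rw [klEstimate_sub_eq hx hR]
  exact ofReal_sq_mul_add_le _ _ _

end MeanSquareConsistency

section LogDistanceMoment

variable {d : ℕ} {f : EuclideanSpace ℝ (Fin d) → ℝ} {ε : ℝ}

lemma le_exp_one_add_G {t : ℝ} (ht : 0 ≤ t) : t ≤ Real.exp 1 + G t := by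
  unfold G
  split_ifs with h
  · linarith [Real.add_one_le_exp (1 : ℝ)]
  · rcases le_total t (Real.exp 1) with hte | hte
    · exact le_add_of_le_of_nonneg hte (mul_nonneg ht (Real.log_nonneg (not_lt.1 h)))
    · have hlog : 1 ≤ Real.log t :=
        (Real.le_log_iff_exp_le ((Real.exp_pos 1).trans_le hte)).2 hte
      exact le_add_of_nonneg_of_le (Real.exp_pos 1).le (le_mul_of_one_le_right ht hlog)

lemma sq_posLog_le (t : ℝ) : Real.posLog t ^ 2 ≤ Real.exp 1 + G (Real.log t ^ 2) := by
  refine le_trans ?_ (le_exp_one_add_G (sq_nonneg _))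
  rw [Real.posLog_apply]
  rcases max_choice 0 (Real.log t) with h | h <;> rw [h]
  rw [zero_pow two_ne_zero]
  exact sq_nonneg _

lemma lintegral_sq_posLog_dist_le [IsProbabilityMeasure (law f)] (hd : 0 < d)
    (hf : AEMeasurable f volume) (hε : 0 ≤ ε) (x : EuclideanSpace ℝ (Fin d)) :
    ∫⁻ y, ENNReal.ofReal (Real.posLog (dist x y) ^ 2) ∂law f
      ≤ ENNReal.ofReal (Real.exp 1) + (1 + (∫⁻ y in {x}ᶜ,
        ENNReal.ofReal (G (Real.log (dist x y) ^ 2)) * ENNReal.ofReal (f y)) ^ (1 + ε)) := by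
  have : Nonempty (Fin d) := ⟨⟨0, hd⟩⟩
  rw [restrict_compl_singleton, ← lintegral_law hf]
  calc ∫⁻ y, ENNReal.ofReal (Real.posLog (dist x y) ^ 2) ∂law f
      ≤ ∫⁻ y, ENNReal.ofReal (Real.exp 1)
        + ENNReal.ofReal (G (Real.log (dist x y) ^ 2)) ∂law f :=
        lintegral_mono fun y =>
          (ENNReal.ofReal_le_ofReal (sq_posLog_le _)).trans ENNReal.ofReal_add_le
    _ = ENNReal.ofReal (Real.exp 1)
        + (∫⁻ y, ENNReal.ofReal (G (Real.log (dist x y) ^ 2)) ∂law f) ^ (1 : ℝ) := by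
        rw [lintegral_add_left measurable_const, lintegral_const, measure_univ, mul_one,
          ENNReal.rpow_one]
    _ ≤ _ := by
        gcongr
        exact rpow_le_one_add_rpow _ zero_le_one (le_add_of_nonneg_right hε)

lemma memLp_posLog_dist [IsProbabilityMeasure (law f)] (hd : 0 < d) (hf : AEMeasurable f volume)
    (hε : 0 ≤ ε) (hK : K₂ f ε < ∞) :
    MemLp (fun p : EuclideanSpace ℝ (Fin d) × EuclideanSpace ℝ (Fin d) =>
      Real.posLog (dist p.1 p.2)) 2 ((law f).prod (law f)) := by
  have hmeas : Measurable fun p : EuclideanSpace ℝ (Fin d) × EuclideanSpace ℝ (Fin d) =>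
      Real.posLog (dist p.1 p.2) := by fun_prop
  refine (memLp_two_iff_integrable_sq hmeas.aestronglyMeasurable).2
    ⟨(hmeas.pow_const 2).aestronglyMeasurable, ?_⟩
  rw [hasFiniteIntegral_iff_ofReal (ae_of_all _ fun p => sq_nonneg _),
    lintegral_prod _ (hmeas.pow_const 2).ennreal_ofReal.aemeasurable]
  refine (lintegral_mono (lintegral_sq_posLog_dist_le hd hf hε)).trans_lt ?_
  rw [lintegral_add_left measurable_const, lintegral_add_left measurable_const,
    lintegral_law hf fun x => _ ^ (1 + ε)]
  simp only [lintegral_const, measure_univ, mul_one]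
  exact ENNReal.add_lt_top.2 ⟨ENNReal.ofReal_lt_top, ENNReal.add_lt_top.2 ⟨ENNReal.one_lt_top, hK⟩⟩

end LogDistanceMoment

end KozachenkoLeonenko

end

open KozachenkoLeonenko in
theorem theorem2_general {d : ℕ} (hd : 0 < d)
    {Ω : Type*} [MeasurableSpace Ω] (P : Measure Ω) [IsProbabilityMeasure P]
    (f : EuclideanSpace ℝ (Fin d) → ℝ) (hf : AEMeasurable f volume) (hf0 : ∀ x, 0 ≤ f x)
    (X : ℕ → Ω → EuclideanSpace ℝ (Fin d)) (hX : ∀ i, Measurable (X i))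
    (hindep : iIndepFun X P) (hdens : ∀ i, P.map (X i) = law f)
    (ε₁ ε₂ R₁ R₂ : ℝ) (hε₁ : 0 < ε₁) (hε₂ : 0 < ε₂) (hR₁ : 0 < R₁) (hR₂ : 0 < R₂)
    (hdist : MemLp (fun p : EuclideanSpace ℝ (Fin d) × EuclideanSpace ℝ (Fin d) =>
      Real.posLog (dist p.1 p.2)) 2 ((law f).prod (law f)))
    (hQ : Q f ε₁ R₁ < ∞) (hT : T f ε₂ R₂ < ∞) :
    Integrable (fun x => f x * Real.log (f x)) volume ∧
    Tendsto (fun N : ℕ => ∫⁻ ω, ENNReal.ofReal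
        ((klEstimate (fun i : Fin N => X i ω) - entropy f) ^ 2) ∂P) atTop (𝓝 0) := by
  have hprob : IsProbabilityMeasure (law f) :=
    hdens 0 ▸ Measure.isProbabilityMeasure_map (hX 0).aemeasurable
  set ε := min 1 (min ε₁ ε₂)
  set R := min R₁ R₂
  have hε : 0 < ε := lt_min one_pos (lt_min hε₁ hε₂)
  have hR : 0 < R := lt_min hR₁ hR₂
  have hQ' := lintegral_maxAvg_lt_top hf hQ hε.le
    ((min_le_right _ _).trans (min_le_left _ _)) (min_le_left _ _ : R ≤ R₁)
  have hT' := lintegral_minAvg_lt_top hf hT hε.le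
    ((min_le_right _ _).trans (min_le_right _ _)) (min_le_right _ _ : R ≤ R₂)
  have hsample (N : ℕ) := lintegral_comp_iIndepFun (fun i : Fin N => hX i)
    (hindep.precomp Fin.val_injective) (fun i => hdens i)
    (((measurable_klEstimate N).sub_const (entropy f)).pow_const 2).ennreal_ofReal
  refine ⟨(integrable_law_iff hf hf0).1 (integrable_log_law hd hf hε hR hQ' hT'),
    (tendsto_add_atTop_iff_nat 2).1 ?_⟩
  simp only [hsample]
  exact tendsto_lintegral_sq_klEstimate_sub_entropy hd hf hf0 hε (min_le_left _ _) hR hdist hQ' hT'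

theorem theorem2 {d : ℕ} (hd : 0 < d)
    {Ω : Type*} [MeasurableSpace Ω] (P : Measure Ω) [IsProbabilityMeasure P]
    (f : EuclideanSpace ℝ (Fin d) → ℝ) (hf : AEMeasurable f volume) (hf0 : ∀ x, 0 ≤ f x)
    (X : ℕ → Ω → EuclideanSpace ℝ (Fin d)) (hX : ∀ i, Measurable (X i))
    (hindep : iIndepFun X P)
    (hdens : ∀ i, P.map (X i) = volume.withDensity (fun x => ENNReal.ofReal (f x)))
    (ε₀ ε₁ ε₂ R₁ R₂ : ℝ) (hε₀ : 0 < ε₀) (hε₁ : 0 < ε₁) (hε₂ : 0 < ε₂)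
    (hR₁ : 0 < R₁) (hR₂ : 0 < R₂)
    (hK : KozachenkoLeonenko.K₂ f ε₀ < ∞)
    (hQ : KozachenkoLeonenko.Q f ε₁ R₁ < ∞)
    (hT : KozachenkoLeonenko.T f ε₂ R₂ < ∞) :
    Integrable (fun x => f x * Real.log (f x)) volume ∧
    Tendsto (fun N : ℕ => ∫⁻ ω, ENNReal.ofReal
        ((KozachenkoLeonenko.klEstimate (fun i : Fin N => X i ω)
          - KozachenkoLeonenko.entropy f) ^ 2) ∂P) atTop (𝓝 0) := by
  have : IsProbabilityMeasure (volume.withDensity fun x => ENNReal.ofReal (f x)) :=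
    hdens 0 ▸ Measure.isProbabilityMeasure_map (hX 0).aemeasurable
  exact theorem2_general hd P f hf hf0 X hX hindep hdens ε₁ ε₂ R₁ R₂ hε₁ hε₂ hR₁ hR₂
    (KozachenkoLeonenko.memLp_posLog_dist hd hf hε₀.le hK) hQ hT
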